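/- Let $\mathfrak g$ be a nilpotent real Lie algebra of dimension $8$, with ascending central series $\mathfrak g_0=\{0\}$ and $\mathfrak g_k=\{X\in\mathfrak g \mid [X,\mathfrak g]\subseteq \mathfrak g_{k-1}\}$ for $k\ge 1$. Let $J$ be a complex structure on $\mathfrak g$, that is, a linear map $J\colon\mathfrak g\to\mathfrak g$ with $J^2=-\mathrm{Id}$ and $[X,Y]+J[JX,Y]+J[X,JY]-[JX,JY]=0$ for all $X,Y\in\mathfrak g$. Assume that $J$ is strongly non-nilpotent, that is, $\mathfrak a_1(J)=\{0\}$, where $\mathfrak a_0(J)=\{0\}$ and $\mathfrak a_k(J)=\{X\in\mathfrak g \mid [X,\mathfrak g]\subseteq\mathfrak a_{k-1}(J)\ \text{and}\ [JX,\mathfrak g]\subseteq\mathfrak a_{k-1}(J)\}$ for $k\ge 1$ (equivalently, the center of $\mathfrak g$ contains no non-zero $J$-invariant subspace). Then $\mathfrak g_2\cap J\mathfrak g_2\neq\{0\}$, and consequently $3\le \dim\mathfrak g_2\le 5$. -/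

import Mathlib

/-- The `k`-th term `𝔤_k` of the ascending central series of a real Lie algebra:
`𝔤_0 = 0` and `𝔤_{k+1} = {X | [X, 𝔤] ⊆ 𝔤_k}` (see `mem_ascendingCentralSeries_succ`). -/
def ascendingCentralSeries (g : Type*) [LieRing g] [LieAlgebra ℝ g] (k : ℕ) : LieIdeal ℝ g :=
  (⊥ : LieIdeal ℝ g).ucs k

theorem ascendingCentralSeries_zero (g : Type*) [LieRing g] [LieAlgebra ℝ g] :
    ascendingCentralSeries g 0 = ⊥ := rfl

theorem mem_ascendingCentralSeries_succ {g : Type*} [LieRing g] [LieAlgebra ℝ g] (k : ℕ) (X : g) :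
    X ∈ ascendingCentralSeries g (k + 1) ↔ ∀ Y : g, ⁅X, Y⁆ ∈ ascendingCentralSeries g k := by
  unfold ascendingCentralSeries
  rw [LieSubmodule.ucs_succ, LieSubmodule.mem_normalizer]
  refine forall_congr' fun Y => ?_
  rw [← lie_skew, neg_mem_iff]

/-- A complex structure on a real Lie algebra: an endomorphism `J` with `J² = -Id` and vanishing
Nijenhuis tensor. -/
structure IsComplexStructure {g : Type*} [LieRing g] [LieAlgebra ℝ g] (J : g →ₗ[ℝ] g) : Prop where
  sq_eq_neg : ∀ X : g, J (J X) = -X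
  nijenhuis : ∀ X Y : g, ⁅X, Y⁆ + J ⁅J X, Y⁆ + J ⁅X, J Y⁆ - ⁅J X, J Y⁆ = 0

/-- The ascending `J`-compatible series: `𝔞_0(J) = 0` and
`𝔞_{k+1}(J) = {X | [X, 𝔤] ⊆ 𝔞_k(J) and [J X, 𝔤] ⊆ 𝔞_k(J)}`. -/
def ascendingCompatibleSeries {g : Type*} [LieRing g] [LieAlgebra ℝ g] (J : g →ₗ[ℝ] g) :
    ℕ → Submodule ℝ g
  | 0 => ⊥
  | k + 1 =>
    { carrier := {X | (∀ Y : g, ⁅X, Y⁆ ∈ ascendingCompatibleSeries J k) ∧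
        ∀ Y : g, ⁅J X, Y⁆ ∈ ascendingCompatibleSeries J k}
      add_mem' := fun {a b} ha hb =>
        ⟨fun Y => by rw [add_lie]; exact add_mem (ha.1 Y) (hb.1 Y),
          fun Y => by rw [map_add, add_lie]; exact add_mem (ha.2 Y) (hb.2 Y)⟩
      zero_mem' := ⟨fun Y => by rw [zero_lie]; exact zero_mem _,
        fun Y => by rw [map_zero, zero_lie]; exact zero_mem _⟩
      smul_mem' := fun c a ha =>
        ⟨fun Y => by rw [smul_lie]; exact Submodule.smul_mem _ c (ha.1 Y),
          fun Y => by rw [map_smul, smul_lie]; exact Submodule.smul_mem _ c (ha.2 Y)⟩ }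

/-- `J` is strongly non-nilpotent (SnN) if `𝔞_1(J) = 0`. -/
def IsStronglyNonNilpotent {g : Type*} [LieRing g] [LieAlgebra ℝ g] (J : g →ₗ[ℝ] g) : Prop :=
  ascendingCompatibleSeries J 1 = ⊥

/-!
Write `Z = 𝔤_1` for the center. Since `𝔞_1(J) = 0`, we have `Z ∩ JZ = 0`. For `X ∈ Z` the Nijenhuis
identity says that `D_X = ad (J X)` is complex linear, and it is nilpotent and nonzero when `X ≠ 0`.
A fact used constantly is that no nonzero complex multiple of `X` lies in the image of `D_X`:
if `[J X, T] = X`, then `[J X, J T] = J X`, so `ad (J T)` has a nonzero eigenvalue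
(`lie_eq_zero_of_mem_span_self`). Also, if `D_X` has complex rank one with kernel `W`, then `W` is an
ideal containing all brackets, and it commutes with the image of `D_X`
(`kernel_commutes_of_rank_one`).

The center is one-dimensional (`finrank_center_eq_one`). The space `Z + JZ` is not an ideal, and
its normalizer is strictly larger; if `dim Z ≥ 2`, counting dimensions leaves `dim Z = 2` and a
`J`-stable `W` of dimension six with `D_X 𝔤 ⊆ W` and `D_X W ⊆ Z + JZ` (`exists_isCenterFlag`).
Eigenvalue arguments then give `D_X W = 0`, so `W` is an abelian ideal, on which `ad Y` and
`ad (J Y)` commute. Comparing these two operators produces a nonzero `A` with `A` and `J A` central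
(`not_isCenterFlag`).

So let `Z = ℝX` and `D = D_X`. Then `D` kills `𝔤_2 + J𝔤_2`. Suppose `𝔤_2 ∩ J𝔤_2 = 0`. Then even
`𝔤_3 ∩ J𝔤_2 = 0` (`eq_zero_of_map_mem_three`), and `D` has complex rank one or two. In rank two
(`finrank_kerLieMap_ne_four`), `D` has a Jordan chain `Y ↦ A ↦ U` with `U ∈ 𝔤_2`, and the
Jacobi and Nijenhuis identities put `J U` into `𝔤_2`. In rank one (`finrank_kerLieMap_ne_six`), with
`W = ker D`, there are three possibilities: `W = 𝔤_2 ⊕ J𝔤_2`, where `W ∩ 𝔤_3` is too small; `W`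
is nonabelian, where its small centralizer puts `J X` in `𝔤_4`; or `W` is abelian and `dim 𝔤_2 = 2`,
where some nonzero `U ∈ 𝔤_2` has `J U ∈ 𝔤_5`. In the last two cases, following how `ad Y` and
`ad (J Y)` lower the central series contradicts `𝔤_3 ∩ J𝔤_2 = 0`.

For the dimensions: `𝔤_2 ∩ J𝔤_2` is `J`-stable and nonzero but does not contain `X`, because
`J X ∉ 𝔤_2`; this gives `dim 𝔤_2 ≥ 3`. On the other side, `𝔤_2` is strictly contained in
`𝔤_2 + J𝔤_2 ⊆ ker D`, which has dimension at most six.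
-/

open Module Submodule

/-! ### Nilpotency and the ascending central series -/

/-- The term `𝔤_k` of the ascending central series as a subspace of `𝔤`. -/
def upperCentral (g : Type*) [LieRing g] [LieAlgebra ℝ g] (k : ℕ) : Submodule ℝ g :=
  (ascendingCentralSeries g k).toSubmodule

section Nilpotent

variable {g : Type*} [LieRing g] [LieAlgebra ℝ g]

theorem mem_upperCentral_succ {k : ℕ} {X : g} :
    X ∈ upperCentral g (k + 1) ↔ ∀ Y : g, ⁅X, Y⁆ ∈ upperCentral g k :=
  mem_ascendingCentralSeries_succ k X

theorem mem_upperCentral_zero {X : g} : X ∈ upperCentral g 0 ↔ X = 0 := Iff.rfl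

theorem mem_upperCentral_one {X : g} : X ∈ upperCentral g 1 ↔ ∀ Y : g, ⁅X, Y⁆ = 0 :=
  mem_upperCentral_succ

theorem lie_mem_upperCentral {k : ℕ} {X : g} (hX : X ∈ upperCentral g k) (Y : g) :
    ⁅X, Y⁆ ∈ upperCentral g k :=
  lie_mem_left ℝ g (ascendingCentralSeries g k) X Y hX

theorem lie_mem_upperCentral' {k : ℕ} {X : g} (hX : X ∈ upperCentral g k) (Y : g) :
    ⁅Y, X⁆ ∈ upperCentral g k := by
  rw [← lie_skew]; exact neg_mem (lie_mem_upperCentral hX Y)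

theorem lie_mem_of_mem_succ {k : ℕ} {X : g} (hX : X ∈ upperCentral g (k + 1)) (Y : g) :
    ⁅X, Y⁆ ∈ upperCentral g k := mem_upperCentral_succ.1 hX Y

theorem lie_mem_of_mem_succ' {k : ℕ} {X : g} (hX : X ∈ upperCentral g (k + 1)) (Y : g) :
    ⁅Y, X⁆ ∈ upperCentral g k := by
  rw [← lie_skew]; exact neg_mem (lie_mem_of_mem_succ hX Y)

theorem upperCentral_mono : Monotone (upperCentral g) :=
  monotone_nat_of_le_succ fun _ _ hX => mem_upperCentral_succ.2 fun Y => lie_mem_upperCentral hX Y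

theorem exists_upperCentral_eq_top [LieRing.IsNilpotent g] : ∃ n, upperCentral g n = ⊤ := by
  obtain ⟨n, hn⟩ := (LieModule.isNilpotent_iff_exists_ucs_eq_top (R := ℝ) (L := g) (M := g)).1
    inferInstance
  exact ⟨n, by simp [upperCentral, ascendingCentralSeries, hn]⟩

/-- A Nakayama-type lemma: a subspace `L` that is recovered modulo `Q` from brackets with
elements of `𝒮` lies in `Q`, because `L ⊆ Q + 𝔤_{k+1}` improves to `L ⊆ Q + 𝔤_k`. -/
theorem le_of_le_sup_span_lie [LieRing.IsNilpotent g] (𝒮 : Set g) {Q L : Submodule ℝ g}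
    (hQ : ∀ s ∈ 𝒮, ∀ q ∈ Q, ⁅s, q⁆ ∈ Q)
    (hL : L ≤ Q ⊔ span ℝ {z | ∃ s ∈ 𝒮, ∃ l ∈ L, ⁅s, l⁆ = z}) : L ≤ Q := by
  have key : ∀ k, L ≤ Q ⊔ upperCentral g k → L ≤ Q := by
    intro k
    induction k with
    | zero =>
      intro h x hx
      obtain ⟨q, hq, t, ht, rfl⟩ := mem_sup.1 (h hx)
      rw [mem_upperCentral_zero.1 ht, add_zero]; exact hq
    | succ k ih =>
      intro h
      refine ih (hL.trans (sup_le le_sup_left (span_le.2 ?_)))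
      rintro _ ⟨s, hs, l, hl, rfl⟩
      obtain ⟨q, hq, t, ht, rfl⟩ := mem_sup.1 (h hl)
      rw [lie_add]
      exact add_mem (mem_sup_left (hQ s hs q hq)) (mem_sup_right (lie_mem_of_mem_succ' ht s))
  obtain ⟨n, hn⟩ := exists_upperCentral_eq_top (g := g)
  exact key n (by rw [hn]; simp)

/-- In a nilpotent Lie algebra, `ad S` has no nonzero eigenvalue on a quotient by an
`ad S`-stable subspace. -/
theorem mem_of_lie_sub_smul_mem [LieRing.IsNilpotent g] {Q : Submodule ℝ g} {S T : g} {c : ℝ}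
    (hQ : ∀ q ∈ Q, ⁅S, q⁆ ∈ Q) (h : ⁅S, T⁆ - c • T ∈ Q) (hc : c ≠ 0) : T ∈ Q := by
  have : span ℝ {T} ≤ Q := by
    refine le_of_le_sup_span_lie {S} (by simpa using hQ) (span_le.2 ?_)
    rintro x rfl
    have e : x = -c⁻¹ • (⁅S, x⁆ - c • x) + c⁻¹ • ⁅S, x⁆ := by
      rw [smul_sub, smul_smul, neg_mul, inv_mul_cancel₀ hc]; module
    rw [SetLike.mem_coe]
    refine (congrArg (· ∈ _) e).mpr (add_mem (mem_sup_left (smul_mem _ _ h))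
      (smul_mem _ _ (mem_sup_right (subset_span ⟨S, rfl, _, mem_span_singleton_self _, rfl⟩))))
  exact this (mem_span_singleton_self T)

theorem eq_zero_of_lie_eq_smul [LieRing.IsNilpotent g] {S T : g} {c : ℝ}
    (h : ⁅S, T⁆ = c • T) (hc : c ≠ 0) : T = 0 := by
  have := mem_of_lie_sub_smul_mem (Q := ⊥) (S := S) (T := T) (by simp) (by simp [h]) hc
  simpa using this

/-- In a nilpotent Lie algebra, `ad S` cannot act invertibly on a two-dimensional subspace of a
quotient by an `ad S`-stable subspace. -/
theorem mem_of_lie_pair [LieRing.IsNilpotent g] {Q : Submodule ℝ g} {S T₁ T₂ : g} {a b c d : ℝ}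
    (hQ : ∀ q ∈ Q, ⁅S, q⁆ ∈ Q) (h₁ : ⁅S, T₁⁆ - (a • T₁ + b • T₂) ∈ Q)
    (h₂ : ⁅S, T₂⁆ - (c • T₁ + d • T₂) ∈ Q) (hdet : a * d - b * c ≠ 0) : T₁ ∈ Q ∧ T₂ ∈ Q := by
  have key : span ℝ {T₁, T₂} ≤ Q := by
    have m₁ : ⁅S, T₁⁆ ∈ Q ⊔ span ℝ {z | ∃ s ∈ ({S} : Set g), ∃ l ∈ span ℝ {T₁, T₂}, ⁅s, l⁆ = z} :=
      mem_sup_right (subset_span ⟨S, rfl, _, subset_span (by simp), rfl⟩)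
    have m₂ : ⁅S, T₂⁆ ∈ Q ⊔ span ℝ {z | ∃ s ∈ ({S} : Set g), ∃ l ∈ span ℝ {T₁, T₂}, ⁅s, l⁆ = z} :=
      mem_sup_right (subset_span ⟨S, rfl, _, subset_span (by simp), rfl⟩)
    have n₁ := sub_mem m₁ (mem_sup_left h₁)
    have n₂ := sub_mem m₂ (mem_sup_left h₂)
    refine le_of_le_sup_span_lie {S} (by simpa using hQ) (span_le.2 ?_)
    rintro x (rfl | rfl)
    · have e := add_mem (smul_mem _ ((a * d - b * c)⁻¹ * d) n₁)
        (smul_mem _ ((a * d - b * c)⁻¹ * -b) n₂)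
      rw [SetLike.mem_coe]
      convert e using 1
      match_scalars <;> field_simp <;> ring
    · have e := add_mem (smul_mem _ ((a * d - b * c)⁻¹ * -c) n₁)
        (smul_mem _ ((a * d - b * c)⁻¹ * a) n₂)
      rw [SetLike.mem_coe]
      convert e using 1
      match_scalars <;> field_simp <;> ring
  exact ⟨key (subset_span (by simp)), key (subset_span (by simp))⟩

/-- A subspace stable under all brackets and not inside `𝔤_k` reaches a new element already
in `𝔤_{k+1}`. -/
theorem exists_mem_upperCentral_succ [LieRing.IsNilpotent g] {I : Submodule ℝ g} {k : ℕ}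
    (hI : ∀ x ∈ I, ∀ Y, ⁅x, Y⁆ ∈ I) (hk : ¬ I ≤ upperCentral g k) :
    ∃ v ∈ I, v ∈ upperCentral g (k + 1) ∧ v ∉ upperCentral g k := by
  by_contra! hcon
  apply hk
  have key : ∀ j x, x ∈ I → x ∈ upperCentral g (k + j) → x ∈ upperCentral g k := by
    intro j
    induction j with
    | zero => intro x _ h; exact h
    | succ j ih =>
      intro x hx h
      exact hcon x hx (mem_upperCentral_succ.2 fun Y => ih _ (hI x hx Y) (lie_mem_of_mem_succ h Y))
  obtain ⟨n, hn⟩ := exists_upperCentral_eq_top (g := g)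
  intro x hx
  refine key n x hx (upperCentral_mono (Nat.le_add_left n k) ?_)
  rw [hn]; trivial

/-- The last term of the central series inside a proper subspace `I`: when `I` is a subalgebra, the
next term supplies an element of its normalizer outside `I`. -/
theorem exists_upperCentral_le_not_le [LieRing.IsNilpotent g] {I : Submodule ℝ g} (hI : I ≠ ⊤) :
    ∃ k, upperCentral g k ≤ I ∧ ¬ upperCentral g (k + 1) ≤ I := by
  by_contra! hcon
  have : ∀ k, upperCentral g k ≤ I := by
    intro k
    induction k with
    | zero => intro x hx; rw [mem_upperCentral_zero.1 hx]; exact zero_mem _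
    | succ k ih => exact hcon k ih
  obtain ⟨n, hn⟩ := exists_upperCentral_eq_top (g := g)
  exact hI (top_le_iff.1 (hn ▸ this n))

/-- Intersecting a subspace stable under all brackets with the central series gains a dimension
at each step until the subspace is exhausted. -/
theorem le_finrank_inf_upperCentral [LieRing.IsNilpotent g] [Module.Finite ℝ g]
    {I : Submodule ℝ g} (hI : ∀ x ∈ I, ∀ Y, ⁅x, Y⁆ ∈ I) :
    ∀ k, k ≤ finrank ℝ I → k ≤ finrank ℝ ↥(I ⊓ upperCentral g k) := by
  intro k
  induction k with
  | zero => simp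
  | succ k ih =>
    intro hk
    by_cases h : I ≤ upperCentral g (k + 1)
    · rwa [inf_eq_left.2 h]
    obtain ⟨v, hv, hv1, hv2⟩ := exists_mem_upperCentral_succ hI
      (fun h' => h (h'.trans (upperCentral_mono k.le_succ)))
    have hlt : I ⊓ upperCentral g k < I ⊓ upperCentral g (k + 1) := by
      refine lt_of_le_of_ne (inf_le_inf_left _ (upperCentral_mono k.le_succ)) fun e => hv2 ?_
      have : v ∈ I ⊓ upperCentral g (k + 1) := ⟨hv, hv1⟩
      rw [← e] at this
      exact this.2
    have := finrank_lt_finrank_of_lt hlt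
    have := ih (by omega)
    omega

theorem le_upperCentral_of_finrank_le [LieRing.IsNilpotent g] [Module.Finite ℝ g]
    {I : Submodule ℝ g} (hI : ∀ x ∈ I, ∀ Y, ⁅x, Y⁆ ∈ I) {k : ℕ} (hk : finrank ℝ I ≤ k) :
    I ≤ upperCentral g k := by
  have h := le_finrank_inf_upperCentral hI _ le_rfl
  have e : I ⊓ upperCentral g (finrank ℝ I) = I := eq_of_le_of_finrank_le inf_le_left h
  exact (inf_eq_left.1 e).trans (upperCentral_mono hk)

end Nilpotent

/-! ### Subspaces stable under a complex structure -/

section ComplexSubspaces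

variable {V : Type*} [AddCommGroup V] [Module ℝ V] {J : V →ₗ[ℝ] V}

/-- The determinant of `J` on `S` squares to `(-1) ^ dim S`. -/
theorem even_finrank_of_sq_eq_neg (hJ : ∀ x, J (J x) = -x) {S : Submodule ℝ V}
    (hS : ∀ x ∈ S, J x ∈ S) : Even (finrank ℝ S) := by
  have h2 : (J.restrict hS) ∘ₗ (J.restrict hS) = (-1 : ℝ) • LinearMap.id := by
    ext x; simp [hJ]
  have h3 := congrArg LinearMap.det h2
  rw [LinearMap.det_comp, LinearMap.det_smul, LinearMap.det_id, mul_one] at h3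
  by_contra hodd
  rw [Nat.not_even_iff_odd] at hodd
  rw [hodd.neg_one_pow] at h3
  nlinarith [mul_self_nonneg (LinearMap.det (J.restrict hS))]

/-- The subspace `S + ℂT`, where `i` acts as `J`. -/
def adjoinComplex (J : V →ₗ[ℝ] V) (S : Submodule ℝ V) (T : V) : Submodule ℝ V :=
  S ⊔ span ℝ {T, J T}

theorem mem_adjoinComplex {S : Submodule ℝ V} {T x : V} :
    x ∈ adjoinComplex J S T ↔ ∃ s ∈ S, ∃ a b : ℝ, x = s + (a • T + b • J T) := by
  rw [adjoinComplex, mem_sup]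
  constructor
  · rintro ⟨s, hs, t, ht, rfl⟩
    obtain ⟨a, b, rfl⟩ := mem_span_pair.1 ht
    exact ⟨s, hs, a, b, rfl⟩
  · rintro ⟨s, hs, a, b, rfl⟩
    exact ⟨s, hs, _, mem_span_pair.2 ⟨a, b, rfl⟩, rfl⟩

theorem le_adjoinComplex {S : Submodule ℝ V} {T : V} : S ≤ adjoinComplex J S T := le_sup_left

theorem self_mem_adjoinComplex {S : Submodule ℝ V} {T : V} : T ∈ adjoinComplex J S T :=
  mem_sup_right (subset_span (by simp))

theorem adjoinComplex_le {S S' : Submodule ℝ V} (hS' : ∀ x ∈ S', J x ∈ S') {T : V} (h : S ≤ S')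
    (hT : T ∈ S') : adjoinComplex J S T ≤ S' := by
  refine sup_le h (span_le.2 ?_)
  rintro x (rfl | rfl)
  exacts [hT, hS' _ hT]

theorem adjoinComplex_stable (hJ : ∀ x, J (J x) = -x) {S : Submodule ℝ V}
    (hS : ∀ x ∈ S, J x ∈ S) {T : V} : ∀ x ∈ adjoinComplex J S T, J x ∈ adjoinComplex J S T := by
  intro x hx
  obtain ⟨s, hs, a, b, rfl⟩ := mem_adjoinComplex.1 hx
  refine mem_adjoinComplex.2 ⟨J s, hS s hs, -b, a, ?_⟩
  simp only [map_add, map_smul, hJ]; module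

theorem finrank_adjoinComplex [Module.Finite ℝ V] (hJ : ∀ x, J (J x) = -x) {S : Submodule ℝ V}
    (hS : ∀ x ∈ S, J x ∈ S) {T : V} (hT : T ∉ S) :
    finrank ℝ (adjoinComplex J S T) = finrank ℝ S + 2 := by
  have hlt : S < adjoinComplex J S T :=
    lt_of_le_of_ne le_adjoinComplex fun e => hT (e ▸ self_mem_adjoinComplex)
  have h1 := finrank_lt_finrank_of_lt hlt
  have h2 : finrank ℝ (adjoinComplex J S T) ≤ finrank ℝ S + 2 := by
    refine (finrank_add_le_finrank_add_finrank _ _).trans (Nat.add_le_add_left ?_ _)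
    classical
    have := finrank_span_finset_le_card (R := ℝ) ({T, J T} : Finset V)
    rw [Finset.coe_pair] at this
    exact this.trans Finset.card_le_two
  have e1 := even_finrank_of_sq_eq_neg hJ hS
  have e2 := even_finrank_of_sq_eq_neg hJ (adjoinComplex_stable hJ hS (T := T))
  obtain ⟨p, hp⟩ := e1
  obtain ⟨q, hq⟩ := e2
  omega

theorem exists_decomp_of_finrank_le [Module.Finite ℝ V] (hJ : ∀ x, J (J x) = -x)
    {S S' : Submodule ℝ V} (hS : ∀ x ∈ S, J x ∈ S) (hS' : ∀ x ∈ S', J x ∈ S') (hle : S ≤ S')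
    {T : V} (hT : T ∉ S) (hT' : T ∈ S') (hrank : finrank ℝ S' ≤ finrank ℝ S + 2) :
    ∀ x ∈ S', ∃ s ∈ S, ∃ a b : ℝ, x = s + (a • T + b • J T) := by
  have : adjoinComplex J S T = S' := by
    refine eq_of_le_of_finrank_le (adjoinComplex_le hS' hle hT') ?_
    rw [finrank_adjoinComplex hJ hS hT]; exact hrank
  intro x hx
  exact mem_adjoinComplex.1 (this ▸ hx)

/-- Nonzero complex multiples of a vector outside a `J`-stable subspace stay outside. -/
theorem smul_add_smul_notMem (hJ : ∀ x, J (J x) = -x) {S : Submodule ℝ V}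
    (hS : ∀ x ∈ S, J x ∈ S) {T : V} (hT : T ∉ S) {a b : ℝ} (hab : a • T + b • J T ∈ S) :
    a = 0 ∧ b = 0 := by
  by_contra hne
  have hpos : a * a + b * b ≠ 0 := by
    intro h
    exact hne ⟨by nlinarith [mul_self_nonneg a, mul_self_nonneg b],
      by nlinarith [mul_self_nonneg a, mul_self_nonneg b]⟩
  apply hT
  have h1 := sub_mem (smul_mem S a hab) (smul_mem S b (hS _ hab))
  have e : (a * a + b * b) • T = a • (a • T + b • J T) - b • J (a • T + b • J T) := by
    simp only [map_add, map_smul, hJ]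
    module
  rw [← e] at h1
  exact (smul_mem_iff S hpos).1 h1

end ComplexSubspaces

/-! ### Complex structures and the operators `ad (J X)` for central `X` -/

section ComplexStructure

variable {g : Type*} [LieRing g] [LieAlgebra ℝ g] {J : g →ₗ[ℝ] g}

theorem IsComplexStructure.lie_map_map (hJ : IsComplexStructure J) (X Y : g) :
    ⁅J X, J Y⁆ = ⁅X, Y⁆ + J ⁅J X, Y⁆ + J ⁅X, J Y⁆ :=
  (sub_eq_zero.1 (hJ.nijenhuis X Y)).symm

theorem IsStronglyNonNilpotent.eq_zero (hs : IsStronglyNonNilpotent J) {X : g}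
    (h₁ : X ∈ upperCentral g 1) (h₂ : J X ∈ upperCentral g 1) : X = 0 := by
  have : X ∈ ascendingCompatibleSeries J 1 :=
    ⟨fun Y => mem_upperCentral_one.1 h₁ Y, fun Y => mem_upperCentral_one.1 h₂ Y⟩
  rw [hs] at this
  simpa using this

theorem eq_zero_of_map_eq_smul (hJ : IsComplexStructure J) {A : g} {r : ℝ} (h : J A = r • A) :
    A = 0 := by
  have h2 := hJ.sq_eq_neg A
  rw [h, map_smul, h, smul_smul] at h2
  have h3 : (r * r + 1) • A = 0 := by rw [add_smul, h2]; simp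
  exact (smul_eq_zero.1 h3).resolve_left (by nlinarith [mul_self_nonneg r])

theorem eq_zero_of_smul_add_smul (hJ : IsComplexStructure J) {A : g} (hA : A ≠ 0) {a b : ℝ}
    (h : a • A + b • J A = 0) : a = 0 ∧ b = 0 :=
  smul_add_smul_notMem (S := ⊥) hJ.sq_eq_neg (by simp) (by simpa using hA) (by simpa using h)

theorem map_ne_zero_of_ne_zero (hJ : IsComplexStructure J) {A : g} (hA : A ≠ 0) : J A ≠ 0 := by
  intro h
  have := hJ.sq_eq_neg A
  rw [h, map_zero, zero_eq_neg] at this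
  exact hA this

/-- For central `X`, the operator `ad (J X)` is complex linear. -/
theorem lie_map_of_central (hJ : IsComplexStructure J) {X : g} (hX : X ∈ upperCentral g 1)
    (Y : g) : ⁅J X, J Y⁆ = J ⁅J X, Y⁆ := by
  rw [hJ.lie_map_map, mem_upperCentral_one.1 hX, mem_upperCentral_one.1 hX]; simp

theorem lie_map_lie_comm (hJ : IsComplexStructure J) {X X' : g} (hX : X ∈ upperCentral g 1)
    (hX' : X' ∈ upperCentral g 1) (T : g) : ⁅J X, ⁅J X', T⁆⁆ = ⁅J X', ⁅J X, T⁆⁆ := by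
  have h : ⁅J X, J X'⁆ = 0 := by
    rw [lie_map_of_central hJ hX, ← lie_skew, mem_upperCentral_one.1 hX']; simp
  rw [leibniz_lie, h, zero_lie, zero_add]

theorem eq_zero_of_map_mem_two (hJ : IsComplexStructure J) (hs : IsStronglyNonNilpotent J) {X : g}
    (hX : X ∈ upperCentral g 1) (hX2 : J X ∈ upperCentral g 2) : X = 0 := by
  refine hs.eq_zero hX (mem_upperCentral_one.2 fun Y => ?_)
  refine hs.eq_zero (lie_mem_of_mem_succ hX2 Y) ?_
  rw [← lie_map_of_central hJ hX]
  exact lie_mem_of_mem_succ hX2 _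

/-- If `X` is central, no nonzero complex multiple of `X` lies in the image of `ad (J X)`:
otherwise some `ad T` would have `J X` as an eigenvector with nonzero eigenvalue. -/
theorem lie_eq_zero_of_mem_span_self [LieRing.IsNilpotent g] (hJ : IsComplexStructure J) {X T : g}
    (hX : X ∈ upperCentral g 1) {a b : ℝ} (h : ⁅J X, T⁆ = a • X + b • J X) : ⁅J X, T⁆ = 0 := by
  by_cases hX0 : X = 0
  · simp [hX0]
  have h1 : ⁅a • J T + b • T, J X⁆ = (-(a * a + b * b)) • J X := by
    rw [← lie_skew, lie_add, lie_smul, lie_smul, lie_map_of_central hJ hX, h]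
    simp only [map_add, map_smul, hJ.sq_eq_neg]
    module
  by_cases hc : a * a + b * b = 0
  · have ha : a = 0 := by nlinarith [mul_self_nonneg a, mul_self_nonneg b]
    have hb : b = 0 := by nlinarith [mul_self_nonneg a, mul_self_nonneg b]
    rw [h, ha, hb]; simp
  · exact absurd (eq_zero_of_lie_eq_smul h1 (neg_ne_zero.2 hc)) (map_ne_zero_of_ne_zero hJ hX0)

/-- If `𝔤_2 ∩ J𝔤_2 = 0`, then also `𝔤_3 ∩ J𝔤_2 = 0`: for `T ∈ 𝔤_2` with `J T ∈ 𝔤_3`, the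
Nijenhuis identity places `J([J T, Y] + [T, J Y])` in `𝔤_2`, so `[J T, Y] = -[T, J Y]` is
central. -/
theorem eq_zero_of_map_mem_three (hJ : IsComplexStructure J)
    (hC : ∀ T : g, T ∈ upperCentral g 2 → J T ∈ upperCentral g 2 → T = 0) {T : g}
    (hT : T ∈ upperCentral g 2) (hT3 : J T ∈ upperCentral g 3) : T = 0 := by
  refine hC T hT (mem_upperCentral_succ.2 fun Y => ?_)
  have hsum : ⁅J T, Y⁆ + ⁅T, J Y⁆ = 0 := by
    refine hC _ (add_mem (lie_mem_of_mem_succ hT3 Y) (lie_mem_upperCentral hT _)) ?_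
    have e : J (⁅J T, Y⁆ + ⁅T, J Y⁆) = ⁅J T, J Y⁆ - ⁅T, Y⁆ := by
      rw [hJ.lie_map_map, map_add]; abel
    rw [e]
    exact sub_mem (lie_mem_of_mem_succ hT3 _) (lie_mem_upperCentral hT _)
  rw [eq_neg_of_add_eq_zero_left hsum]
  exact neg_mem (lie_mem_of_mem_succ hT _)

/-- Let `X` be central and suppose that `ad (J X)` has complex rank one, with kernel `W`. Then `W`
contains all brackets, and `W` commutes with the image of `ad (J X)`. -/
theorem kernel_commutes_of_rank_one [LieRing.IsNilpotent g] [Module.Finite ℝ g]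
    (hJ : IsComplexStructure J) {X : g} (hX : X ∈ upperCentral g 1) {W : Submodule ℝ g}
    (hW : ∀ T, T ∈ W ↔ ⁅J X, T⁆ = 0) (hrank : finrank ℝ W + 2 = finrank ℝ g) :
    (∀ Y T : g, T ∈ W → ⁅⁅J X, Y⁆, T⁆ = 0) ∧ ∀ Y Y' : g, ⁅Y, Y'⁆ ∈ W := by
  have hWJ : ∀ x ∈ W, J x ∈ W := by
    intro x hx
    rw [hW, lie_map_of_central hJ hX, (hW x).1 hx, map_zero]
  have hWtop : W ≠ ⊤ := by
    rintro rfl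
    rw [finrank_top] at hrank
    omega
  -- a proper subalgebra of a nilpotent Lie algebra is properly contained in its normalizer
  obtain ⟨k, hk, hk'⟩ := exists_upperCentral_le_not_le hWtop
  obtain ⟨Y₀, hY₀k, hY₀⟩ := Set.not_subset.1 hk'
  have hnorm : ∀ T ∈ W, ⁅Y₀, T⁆ ∈ W := fun T _ => hk (lie_mem_of_mem_succ hY₀k T)
  have hdec : ∀ x, ∃ w ∈ W, ∃ a b : ℝ, x = w + (a • Y₀ + b • J Y₀) := fun x =>
    exists_decomp_of_finrank_le hJ.sq_eq_neg hWJ (S' := ⊤) (by simp) le_top hY₀ mem_top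
      (by rw [finrank_top]; omega) x mem_top
  obtain ⟨A, hA⟩ : ∃ A, ⁅J X, Y₀⁆ = A := ⟨_, rfl⟩
  have hJA : ⁅J X, J Y₀⁆ = J A := by rw [lie_map_of_central hJ hX, hA]
  have hA0 : A ≠ 0 := fun h => hY₀ ((hW _).2 (hA.trans h))
  have hD : ∀ w ∈ W, ∀ a b : ℝ, ⁅J X, w + (a • Y₀ + b • J Y₀)⁆ = a • A + b • J A := by
    intro w hw a b
    simp only [lie_add, lie_smul, (hW w).1 hw, hA, hJA, zero_add]
  have hder : ∀ Y : g, ∀ T ∈ W, ⁅J X, ⁅Y, T⁆⁆ = ⁅⁅J X, Y⁆, T⁆ := by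
    intro Y T hT
    rw [leibniz_lie, (hW T).1 hT, lie_zero, add_zero]
  have hAT : ∀ T ∈ W, ⁅A, T⁆ = 0 := by
    intro T hT
    rw [← hA, ← hder _ _ hT]
    exact (hW _).1 (hnorm T hT)
  have hJAT' : ∀ T ∈ W, ∃ a : ℝ, ⁅J A, T⁆ = a • A := by
    intro T hT
    obtain ⟨w, hw, a, b, hab⟩ := hdec ⁅J Y₀, T⁆
    have h1 : ⁅J A, T⁆ = a • A + b • J A := by
      rw [← hD w hw, ← hab, hder _ _ hT, hJA]
    by_cases hb : b = 0
    · exact ⟨a, by rw [h1, hb]; simp⟩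
    exfalso
    have h2 : J A ∈ span ℝ {A} := by
      refine mem_of_lie_sub_smul_mem (S := T) (c := -b) ?_ ?_ (neg_ne_zero.2 hb)
      · intro q hq
        obtain ⟨r, rfl⟩ := mem_span_singleton.1 hq
        rw [lie_smul, ← lie_skew, hAT T hT]; simp
      · rw [← lie_skew, h1]
        exact mem_span_singleton.2 ⟨-a, by module⟩
    obtain ⟨r, hr⟩ := mem_span_singleton.1 h2
    exact hA0 (eq_zero_of_map_eq_smul hJ hr.symm)
  have hJAT : ∀ T ∈ W, ⁅J A, T⁆ = 0 := by
    intro T hT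
    obtain ⟨a, ha⟩ := hJAT' T hT
    obtain ⟨b, hb⟩ := hJAT' (J T) (hWJ T hT)
    have h1 := hJ.lie_map_map A T
    rw [hAT T hT, hAT _ (hWJ T hT), ha, hb, map_smul] at h1
    have h2 := eq_zero_of_smul_add_smul hJ hA0 (a := b) (b := -a) (by rw [h1]; simp)
    rw [ha, neg_eq_zero.1 h2.2, zero_smul]
  have hcomm : ∀ Y T : g, T ∈ W → ⁅⁅J X, Y⁆, T⁆ = 0 := by
    intro Y T hT
    obtain ⟨w, hw, a, b, rfl⟩ := hdec Y
    rw [hD w hw, add_lie, smul_lie, smul_lie, hAT T hT, hJAT T hT]; simp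
  have hideal : ∀ Y : g, ∀ T ∈ W, ⁅Y, T⁆ ∈ W := by
    intro Y T hT
    rw [hW, hder _ _ hT, hcomm _ _ hT]
  have hYJY : ⁅Y₀, J Y₀⁆ ∈ W := by
    obtain ⟨w, hw, a, b, hab⟩ := hdec ⁅Y₀, J Y₀⁆
    have hb : b = 0 := by
      by_contra hb
      have h2 : J Y₀ ∈ W ⊔ span ℝ {Y₀} := by
        refine mem_of_lie_sub_smul_mem (S := Y₀) (c := b) ?_ ?_ hb
        · intro q hq
          obtain ⟨w', hw', t, ht, rfl⟩ := mem_sup.1 hq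
          obtain ⟨r, rfl⟩ := mem_span_singleton.1 ht
          rw [lie_add, lie_smul, lie_self, smul_zero, add_zero]
          exact mem_sup_left (hideal _ _ hw')
        · rw [hab]
          exact mem_sup.2 ⟨w, hw, a • Y₀, smul_mem _ _ (mem_span_singleton_self _), by module⟩
      obtain ⟨w', hw', t, ht, hr⟩ := mem_sup.1 h2
      obtain ⟨r, rfl⟩ := mem_span_singleton.1 ht
      have h3 : (-r) • Y₀ + (1 : ℝ) • J Y₀ ∈ W := by
        rw [← hr]
        convert hw' using 1
        module
      exact one_ne_zero (smul_add_smul_notMem hJ.sq_eq_neg hWJ hY₀ h3).2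
    have ha : a = 0 := by
      by_contra ha
      refine hY₀ (mem_of_lie_sub_smul_mem (S := J Y₀) (c := -a) (hideal _) ?_ (neg_ne_zero.2 ha))
      rw [← lie_skew, hab, hb]
      convert neg_mem hw using 1
      module
    rw [hab, ha, hb]
    simpa using hw
  refine ⟨hcomm, fun Y Y' => ?_⟩
  obtain ⟨w, hw, a, b, rfl⟩ := hdec Y
  obtain ⟨w', hw', a', b', rfl⟩ := hdec Y'
  rw [add_lie, lie_add (a • Y₀ + b • J Y₀)]
  refine add_mem ?_ (add_mem (hideal _ _ hw') ?_)
  · rw [← lie_skew]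
    exact neg_mem (hideal _ _ hw)
  · have e : ⁅a • Y₀ + b • J Y₀, a' • Y₀ + b' • J Y₀⁆ = (a * b' - b * a') • ⁅Y₀, J Y₀⁆ := by
      simp only [add_lie, lie_add, smul_lie, lie_smul, lie_self, ← lie_skew (J Y₀) Y₀]
      module
    rw [e]
    exact smul_mem _ _ hYJY

/-- The kernel of `ad (J X)`. -/
def kerLieMap (J : g →ₗ[ℝ] g) (X : g) : Submodule ℝ g := LinearMap.ker (LieAlgebra.ad ℝ g (J X))

theorem mem_kerLieMap {X T : g} : T ∈ kerLieMap J X ↔ ⁅J X, T⁆ = 0 := by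
  simp [kerLieMap]

theorem kerLieMap_stable (hJ : IsComplexStructure J) {X : g} (hX : X ∈ upperCentral g 1) :
    ∀ T ∈ kerLieMap J X, J T ∈ kerLieMap J X := by
  intro T hT
  rw [mem_kerLieMap] at *
  rw [lie_map_of_central hJ hX, hT, map_zero]

theorem kerLieMap_ne_top (hs : IsStronglyNonNilpotent J) {X : g}
    (hX : X ∈ upperCentral g 1) (hX0 : X ≠ 0) : kerLieMap J X ≠ ⊤ := by
  intro h
  refine hX0 (hs.eq_zero hX (mem_upperCentral_one.2 fun Y => ?_))
  rw [← mem_kerLieMap, h]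
  trivial

/-- A proper `J`-stable subspace has real codimension at least two. -/
theorem finrank_add_two_le [Module.Finite ℝ g] (hJ : IsComplexStructure J) {S : Submodule ℝ g}
    (hS : ∀ x ∈ S, J x ∈ S) (htop : S ≠ ⊤) : finrank ℝ S + 2 ≤ finrank ℝ g := by
  have h1 := finrank_lt (lt_top_iff_ne_top.2 htop).ne
  obtain ⟨p, hp⟩ := even_finrank_of_sq_eq_neg hJ.sq_eq_neg hS
  have h2 := even_finrank_of_sq_eq_neg hJ.sq_eq_neg (S := ⊤) (by simp)
  rw [finrank_top] at h2
  obtain ⟨q, hq⟩ := h2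
  omega

end ComplexStructure

/-! ### The rank-one case: lowering the central series -/

section RankOne

variable {g : Type*} [LieRing g] [LieAlgebra ℝ g] {J : g →ₗ[ℝ] g}

theorem mem_upperCentral_succ_of_decomp {W : Submodule ℝ g} {Y T : g} {k : ℕ}
    (hdec : ∀ x, ∃ w ∈ W, ∃ a b : ℝ, x = w + (a • Y + b • J Y)) (hW : ∀ w ∈ W, ⁅w, T⁆ = 0)
    (h₁ : ⁅Y, T⁆ ∈ upperCentral g k) (h₂ : ⁅J Y, T⁆ ∈ upperCentral g k) :
    T ∈ upperCentral g (k + 1) := by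
  refine mem_upperCentral_succ.2 fun x => ?_
  obtain ⟨w, hw, a, b, rfl⟩ := hdec x
  rw [← lie_skew, add_lie, add_lie, smul_lie, smul_lie, hW w hw, zero_add]
  exact neg_mem (add_mem (smul_mem _ _ h₁) (smul_mem _ _ h₂))

theorem lie_lie_comm_of_commutes {W : Submodule ℝ g} (hWb : ∀ Y Y' : g, ⁅Y, Y'⁆ ∈ W) {T : g}
    (hT : ∀ w ∈ W, ⁅w, T⁆ = 0) (Y Y' : g) : ⁅Y, ⁅Y', T⁆⁆ = ⁅Y', ⁅Y, T⁆⁆ := by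
  rw [leibniz_lie, hT _ (hWb Y Y'), zero_add]

/-- If all brackets lie in `W`, the centralizer of `W` is stable under brackets. -/
theorem lie_lie_eq_zero_of_commutes {W : Submodule ℝ g} (hWb : ∀ Y Y' : g, ⁅Y, Y'⁆ ∈ W) {T : g}
    (hT : ∀ w ∈ W, ⁅w, T⁆ = 0) (Y : g) : ∀ w ∈ W, ⁅w, ⁅Y, T⁆⁆ = 0 := by
  intro w hw
  rw [leibniz_lie, hT _ (hWb w Y), hT w hw, lie_zero, zero_add]

/-- If `X` is central and `J X` commutes with all brackets, then `A = [J X, Y]` satisfies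
`[J Y, A] = [Y, J A]`, since `ad Y` and `ad (J Y)` commute on `J X`. -/
theorem lie_map_lie_eq (hJ : IsComplexStructure J) {X : g} (hX : X ∈ upperCentral g 1)
    {W : Submodule ℝ g} (hWb : ∀ Y Y' : g, ⁅Y, Y'⁆ ∈ W) (hXW : ∀ w ∈ W, ⁅w, J X⁆ = 0) (Y : g) :
    ⁅J Y, ⁅J X, Y⁆⁆ = ⁅Y, J ⁅J X, Y⁆⁆ := by
  rw [← lie_map_of_central hJ hX, ← lie_skew (J X) Y, ← lie_skew (J X) (J Y), lie_neg, lie_neg,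
    lie_lie_comm_of_commutes hWb hXW]

theorem lie_map_map_of_lie_map_eq (hJ : IsComplexStructure J) {Y A : g}
    (h : ⁅J Y, A⁆ = ⁅Y, J A⁆) : ⁅J Y, J A⁆ = ⁅Y, A⁆ + (2 : ℝ) • J ⁅J Y, A⁆ := by
  rw [hJ.lie_map_map, ← h, two_smul, add_assoc]

/-- The rank-one case with `J X ∈ 𝔤_4`: for `A = [J X, Y]`, both `A` and `J A` would lie in
`𝔤_2`. -/
theorem map_notMem_upperCentral_four [LieRing.IsNilpotent g] [Module.Finite ℝ g]
    (hJ : IsComplexStructure J)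
    (hC : ∀ T : g, T ∈ upperCentral g 2 → J T ∈ upperCentral g 2 → T = 0)
    {X : g} (hX : X ∈ upperCentral g 1) {W : Submodule ℝ g}
    (hW : ∀ T, T ∈ W ↔ ⁅J X, T⁆ = 0) (hrank : finrank ℝ W + 2 = finrank ℝ g) :
    J X ∉ upperCentral g 4 := by
  intro h4
  obtain ⟨hcomm, hWb⟩ := kernel_commutes_of_rank_one hJ hX hW hrank
  have hWJ : ∀ x ∈ W, J x ∈ W := by
    intro x hx
    rw [hW, lie_map_of_central hJ hX, (hW x).1 hx, map_zero]
  have hWtop : ¬ (⊤ : Submodule ℝ g) ≤ W := by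
    intro h
    rw [top_le_iff.1 h, finrank_top] at hrank
    omega
  obtain ⟨Y, -, hY⟩ := Set.not_subset.1 hWtop
  have hdec : ∀ x, ∃ w ∈ W, ∃ a b : ℝ, x = w + (a • Y + b • J Y) := fun x =>
    exists_decomp_of_finrank_le hJ.sq_eq_neg hWJ (S' := ⊤) (by simp) le_top hY mem_top
      (by rw [finrank_top]; omega) x mem_top
  obtain ⟨A, hA⟩ : ∃ A, ⁅J X, Y⁆ = A := ⟨_, rfl⟩
  have hJA : ⁅J X, J Y⁆ = J A := by rw [lie_map_of_central hJ hX, hA]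
  have hA0 : A ≠ 0 := fun h => hY ((hW _).2 (hA.trans h))
  have hWA : ∀ w ∈ W, ⁅w, A⁆ = 0 := fun w hw => by
    rw [← lie_skew, ← hA, hcomm _ _ hw, neg_zero]
  have hWJA : ∀ w ∈ W, ⁅w, J A⁆ = 0 := fun w hw => by
    rw [← lie_skew, ← hJA, hcomm _ _ hw, neg_zero]
  have hNA : ⁅J Y, A⁆ = ⁅Y, J A⁆ := by
    rw [← hA]
    exact lie_map_lie_eq hJ hX hWb (fun w hw => by rw [← lie_skew, (hW w).1 hw, neg_zero]) Y
  have hNJA := lie_map_map_of_lie_map_eq hJ hNA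
  have hA3 : A ∈ upperCentral g 3 := hA ▸ lie_mem_of_mem_succ h4 Y
  have hJA3 : J A ∈ upperCentral g 3 := hJA ▸ lie_mem_of_mem_succ h4 (J Y)
  have hNA0 : ⁅J Y, A⁆ = 0 := by
    refine hC _ (lie_mem_of_mem_succ' hA3 _) ?_
    rw [← smul_mem_iff _ (two_ne_zero (α := ℝ)), ← sub_eq_iff_eq_add'.2 hNJA]
    exact sub_mem (lie_mem_of_mem_succ' hJA3 _) (lie_mem_of_mem_succ' hA3 _)
  rw [hNA0, map_zero, smul_zero, add_zero] at hNJA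
  have hMJA : ⁅Y, J A⁆ = 0 := hNA ▸ hNA0
  have hMA : ⁅Y, A⁆ ∈ upperCentral g 1 := by
    refine mem_upperCentral_succ_of_decomp hdec (lie_lie_eq_zero_of_commutes hWb hWA Y) ?_ ?_
    · rw [← hNJA, lie_lie_comm_of_commutes hWb hWJA, hMJA, lie_zero]
      exact zero_mem _
    · rw [lie_lie_comm_of_commutes hWb hWA, hNA0, lie_zero]
      exact zero_mem _
  refine hA0 (hC A (mem_upperCentral_succ_of_decomp hdec hWA hMA ?_)
    (mem_upperCentral_succ_of_decomp hdec hWJA ?_ ?_))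
  · rw [hNA0]; exact zero_mem _
  · rw [hMJA]; exact zero_mem _
  · rw [hNJA]; exact hMA

/-- The rank-one case with abelian kernel `W` of dimension at least six, when `ad (J Y)` kills
`𝔤_2`. Then `ad (J Y)` lowers the central series by two steps on `W`, and for `U ∈ 𝔤_2` with
`J U ∈ 𝔤_5` the element `J[Y, J U]` is squeezed into `𝔤_3 ∩ J𝔤_2`. -/
theorem map_notMem_upperCentral_five (hJ : IsComplexStructure J)
    (hC : ∀ T : g, T ∈ upperCentral g 2 → J T ∈ upperCentral g 2 → T = 0)
    {W : Submodule ℝ g} (hWJ : ∀ x ∈ W, J x ∈ W) (hWb : ∀ Y Y' : g, ⁅Y, Y'⁆ ∈ W)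
    (hab : ∀ w ∈ W, ∀ w' ∈ W, ⁅w, w'⁆ = 0) {Y : g}
    (hdec : ∀ x, ∃ w ∈ W, ∃ a b : ℝ, x = w + (a • Y + b • J Y))
    (hN : ∀ T ∈ upperCentral g 2, ⁅J Y, T⁆ = 0) {U : g} (hUW : U ∈ W)
    (hU : U ∈ upperCentral g 2) (hU0 : U ≠ 0) : J U ∉ upperCentral g 5 := by
  intro h5
  have hcomm : ∀ T ∈ W, ⁅Y, ⁅J Y, T⁆⁆ = ⁅J Y, ⁅Y, T⁆⁆ := fun T hT =>
    lie_lie_comm_of_commutes hWb (fun w hw => hab w hw T hT) _ _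
  have hlower : ∀ i, ∀ T ∈ W, T ∈ upperCentral g (i + 2) → ⁅J Y, T⁆ ∈ upperCentral g i := by
    intro i
    induction i with
    | zero => intro T _ hT; exact mem_upperCentral_zero.2 (hN T hT)
    | succ i ih =>
      intro T hT hTi
      refine mem_upperCentral_succ_of_decomp hdec (fun w hw => hab w hw _ (hWb _ _)) ?_ ?_
      · rw [hcomm T hT]
        exact ih _ (hWb _ _) (lie_mem_of_mem_succ' hTi _)
      · exact ih _ (hWb _ _) (lie_mem_of_mem_succ' hTi _)
  have hJU : J U ∈ W := hWJ U hUW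
  obtain ⟨V, hV⟩ : ∃ V, ⁅Y, J U⁆ = V := ⟨_, rfl⟩
  obtain ⟨μ, hμ⟩ : ∃ μ, ⁅Y, U⁆ = μ := ⟨_, rfl⟩
  have hμ1 : μ ∈ upperCentral g 1 := hμ ▸ lie_mem_of_mem_succ' hU Y
  have hVW : V ∈ W := hV ▸ hWb _ _
  have hNJU : ⁅J Y, J U⁆ = μ + J V := by
    rw [hJ.lie_map_map, hN U hU, hV, hμ, map_zero, add_zero]
  have hJV : J V = ⁅J Y, J U⁆ - μ := by rw [hNJU]; abel
  have hNV : ⁅J Y, V⁆ = ⁅Y, J V⁆ := by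
    rw [hJV, lie_sub, ← lie_skew Y μ, mem_upperCentral_one.1 hμ1, hcomm _ hJU, hV]; simp
  have hNJV := lie_map_map_of_lie_map_eq hJ hNV
  have hN3 : ⁅J Y, J U⁆ ∈ upperCentral g 3 := hlower 3 _ hJU h5
  have hNJV' : ⁅J Y, J V⁆ ∈ upperCentral g 1 := by
    rw [hJV, lie_sub, hN μ (upperCentral_mono (by norm_num) hμ1), sub_zero]
    exact hlower 1 _ (hWb _ _) hN3
  have hV4 : V ∈ upperCentral g 4 := hV ▸ lie_mem_of_mem_succ' h5 Y
  have hNV0 : ⁅J Y, V⁆ = 0 := by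
    refine eq_zero_of_map_mem_three hJ hC (hlower 2 _ hVW hV4) ?_
    rw [← smul_mem_iff _ (two_ne_zero (α := ℝ)), ← sub_eq_iff_eq_add'.2 hNJV]
    exact sub_mem (upperCentral_mono (by norm_num) hNJV') (lie_mem_of_mem_succ' hV4 _)
  rw [hNV0, map_zero, smul_zero, add_zero] at hNJV
  have hV2 : V ∈ upperCentral g 2 := by
    refine mem_upperCentral_succ_of_decomp hdec (fun w hw => hab w hw _ hVW) (hNJV ▸ hNJV') ?_
    rw [hNV0]; exact zero_mem _
  have hV0 : V = 0 := by
    refine eq_zero_of_map_mem_three hJ hC hV2 ?_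
    rw [hJV]
    exact sub_mem hN3 (upperCentral_mono (by norm_num) hμ1)
  refine hU0 (hC U hU (mem_upperCentral_succ_of_decomp hdec (fun w hw => hab w hw _ hJU) ?_ ?_))
  · rw [hV, hV0]; exact zero_mem _
  · rw [hNJU, hV0, map_zero, add_zero]; exact hμ1

end RankOne

/-! ### One-dimensional center: complex rank one -/

section OneDimensionalCenter

variable {g : Type*} [LieRing g] [LieAlgebra ℝ g] {J : g →ₗ[ℝ] g}

theorem finrank_map_complex [Module.Finite ℝ g] (hJ : IsComplexStructure J) (S : Submodule ℝ g) :
    finrank ℝ (S.map J) = finrank ℝ S := by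
  refine (equivMapOfInjective J ?_ S).finrank_eq.symm
  intro x y h
  have := congrArg J h
  rwa [hJ.sq_eq_neg, hJ.sq_eq_neg, neg_inj] at this

theorem sup_map_stable (hJ : IsComplexStructure J) (S : Submodule ℝ g) :
    ∀ x ∈ S ⊔ S.map J, J x ∈ S ⊔ S.map J := by
  intro x hx
  obtain ⟨s, hs, _, ⟨t, ht, rfl⟩, rfl⟩ := mem_sup.1 hx
  rw [map_add, hJ.sq_eq_neg, add_comm]
  exact add_mem (mem_sup_left (neg_mem ht)) (mem_sup_right ⟨s, hs, rfl⟩)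

theorem inf_map_stable (hJ : IsComplexStructure J) (S : Submodule ℝ g) :
    ∀ x ∈ S ⊓ S.map J, J x ∈ S ⊓ S.map J := by
  rintro x ⟨hx, t, ht, rfl⟩
  refine ⟨?_, _, hx, rfl⟩
  rw [hJ.sq_eq_neg]
  exact neg_mem ht

theorem finrank_sup_map_of_inf_eq [Module.Finite ℝ g] (hJ : IsComplexStructure J)
    {S : Submodule ℝ g} (h : ∀ T ∈ S, J T ∈ S → T = 0) :
    finrank ℝ ↥(S ⊔ S.map J) = 2 * finrank ℝ S := by
  have h1 := finrank_sup_add_finrank_inf_eq S (S.map J)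
  have h2 : S ⊓ S.map J = ⊥ := by
    rw [eq_bot_iff]
    rintro _ ⟨hx, t, ht, rfl⟩
    rw [h t ht hx]; simp
  rw [h2, finrank_bot, finrank_map_complex hJ] at h1
  omega

variable [LieRing.IsNilpotent g]

/-- If the center is spanned by `X`, then `ad (J X)` kills `𝔤_2`. -/
theorem upperCentral_two_le_kerLieMap (hJ : IsComplexStructure J) {X : g}
    (hX : X ∈ upperCentral g 1) (hZ : ∀ T ∈ upperCentral g 1, ∃ c : ℝ, T = c • X) :
    upperCentral g 2 ≤ kerLieMap J X := by
  intro T hT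
  obtain ⟨c, hc⟩ := hZ _ (lie_mem_of_mem_succ' hT (J X))
  exact mem_kerLieMap.2 (lie_eq_zero_of_mem_span_self hJ hX (a := c) (b := 0) (by simp [hc]))

theorem sup_map_le_kerLieMap (hJ : IsComplexStructure J) {X : g}
    (hX : X ∈ upperCentral g 1) (hZ : ∀ T ∈ upperCentral g 1, ∃ c : ℝ, T = c • X) :
    upperCentral g 2 ⊔ (upperCentral g 2).map J ≤ kerLieMap J X := by
  have h := upperCentral_two_le_kerLieMap hJ hX hZ
  refine sup_le h ?_
  rintro _ ⟨t, ht, rfl⟩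
  exact kerLieMap_stable hJ hX t (h ht)

theorem le_finrank_upperCentral [Module.Finite ℝ g] {k : ℕ} (hk : k ≤ finrank ℝ g) :
    k ≤ finrank ℝ (upperCentral g k) := by
  have h := le_finrank_inf_upperCentral (I := (⊤ : Submodule ℝ g)) (by simp) k (by simpa using hk)
  rwa [top_inf_eq] at h

theorem exists_mem_two_notMem_one (hg : upperCentral g 1 ≠ ⊤) :
    ∃ U ∈ upperCentral g 2, U ∉ upperCentral g 1 := by
  obtain ⟨v, -, h2, h1⟩ := exists_mem_upperCentral_succ (I := (⊤ : Submodule ℝ g)) (k := 1)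
    (by simp) (fun h => hg (top_le_iff.1 h))
  exact ⟨v, h2, h1⟩

theorem exists_add_smul_of_mem_two [Module.Finite ℝ g] (hg : 1 ≤ finrank ℝ g)
    (h2 : finrank ℝ (upperCentral g 2) = 2) {U : g} (hU : U ∈ upperCentral g 2)
    (hU1 : U ∉ upperCentral g 1) {T : g} (hT : T ∈ upperCentral g 2) :
    ∃ z ∈ upperCentral g 1, ∃ r : ℝ, T = z + r • U := by
  have hu1 := le_finrank_upperCentral (g := g) hg
  have hlt : upperCentral g 1 < upperCentral g 1 ⊔ span ℝ {U} := lt_of_le_of_ne le_sup_left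
    fun e => hU1 (by rw [e]; exact mem_sup_right (mem_span_singleton_self U))
  have hle : upperCentral g 1 ⊔ span ℝ {U} ≤ upperCentral g 2 :=
    sup_le (upperCentral_mono (by norm_num)) ((span_singleton_le_iff_mem _ _).2 hU)
  have h1 := finrank_lt_finrank_of_lt hlt
  have heq : upperCentral g 1 ⊔ span ℝ {U} = upperCentral g 2 :=
    eq_of_le_of_finrank_le hle (by omega)
  rw [← heq] at hT
  obtain ⟨z, hz, _, ht, rfl⟩ := mem_sup.1 hT
  obtain ⟨r, rfl⟩ := mem_span_singleton.1 ht
  exact ⟨z, hz, r, rfl⟩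

/-- With one-dimensional center and `𝔤_2 ∩ J𝔤_2 = 0`, the kernel of `ad (J X)` cannot have
complex codimension one. -/
theorem finrank_kerLieMap_ne_six [Module.Finite ℝ g] (hJ : IsComplexStructure J)
    (hs : IsStronglyNonNilpotent J) (hdim : finrank ℝ g = 8)
    (hC : ∀ T : g, T ∈ upperCentral g 2 → J T ∈ upperCentral g 2 → T = 0) {X : g}
    (hX : X ∈ upperCentral g 1) (hX0 : X ≠ 0)
    (hZ : ∀ T ∈ upperCentral g 1, ∃ c : ℝ, T = c • X) :
    finrank ℝ (kerLieMap J X) ≠ 6 := by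
  intro h6
  obtain ⟨W, hWdef⟩ : ∃ W, kerLieMap J X = W := ⟨_, rfl⟩
  have hW : ∀ T, T ∈ W ↔ ⁅J X, T⁆ = 0 := fun T => hWdef ▸ mem_kerLieMap
  have hWJ := kerLieMap_stable hJ hX
  have hSW := sup_map_le_kerLieMap hJ hX hZ
  have hWtop := kerLieMap_ne_top hs hX hX0
  rw [hWdef] at h6 hWJ hSW hWtop
  have hrank : finrank ℝ W + 2 = finrank ℝ g := by omega
  obtain ⟨-, hWb⟩ := kernel_commutes_of_rank_one hJ hX hW hrank
  have hS := finrank_sup_map_of_inf_eq hJ hC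
  have hS6 := finrank_mono hSW
  have h2 := le_finrank_upperCentral (g := g) (k := 2) (by omega)
  have hJXW : J X ∈ W := by rw [hW, lie_self]
  have hcases : finrank ℝ (upperCentral g 2) = 2 ∨ finrank ℝ (upperCentral g 2) = 3 := by omega
  rcases hcases with h2 | h3
  swap
  · -- here `W = 𝔤_2 ⊕ J𝔤_2` meets `𝔤_3` only in `𝔤_2`
    have hSeq : upperCentral g 2 ⊔ (upperCentral g 2).map J = W :=
      eq_of_le_of_finrank_le hSW (by omega)
    obtain ⟨v, hv, hv3, hv2⟩ := exists_mem_upperCentral_succ (I := W) (k := 2)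
      (fun _ _ _ => hWb _ _) (fun h => hX0 (eq_zero_of_map_mem_two hJ hs hX (h hJXW)))
    rw [← hSeq] at hv
    obtain ⟨s, hs', _, ⟨t, ht, rfl⟩, rfl⟩ := mem_sup.1 hv
    have ht3 : J t ∈ upperCentral g 3 := by
      rw [← add_sub_cancel_left s (J t)]
      exact sub_mem hv3 (upperCentral_mono (by norm_num) hs')
    rw [eq_zero_of_map_mem_three hJ hC ht ht3, map_zero, add_zero] at hv2
    exact hv2 hs'
  have hab : ∀ w ∈ W, ∀ w' ∈ W, ⁅w, w'⁆ = 0 := by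
    by_contra! hcon
    obtain ⟨w₀, hw₀, w₁, hw₁, hne⟩ := hcon
    -- the centralizer of a nonabelian `W` has dimension at most four
    let K : Submodule ℝ g :=
      { carrier := {T | T ∈ W ∧ ∀ w ∈ W, ⁅w, T⁆ = 0}
        add_mem' := fun ha hb => ⟨add_mem ha.1 hb.1, fun w hw => by
          rw [lie_add, ha.2 w hw, hb.2 w hw, add_zero]⟩
        zero_mem' := ⟨zero_mem _, fun w _ => lie_zero w⟩
        smul_mem' := fun c a ha => ⟨smul_mem _ c ha.1, fun w hw => by
          rw [lie_smul, ha.2 w hw, smul_zero]⟩ }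
    have hKW : K ≤ W := fun x hx => hx.1
    have hw₁K : w₁ ∉ K := fun h => hne (h.2 w₀ hw₀)
    have hK4 : finrank ℝ K ≤ 4 := by
      by_contra hK
      have hlt : K < K ⊔ span ℝ {w₁} := lt_of_le_of_ne le_sup_left fun e =>
        hw₁K (e ▸ mem_sup_right (mem_span_singleton_self w₁))
      have hle : K ⊔ span ℝ {w₁} ≤ W :=
        sup_le hKW ((span_singleton_le_iff_mem _ _).2 hw₁)
      have h1 := finrank_lt_finrank_of_lt hlt
      have heq : K ⊔ span ℝ {w₁} = W := eq_of_le_of_finrank_le hle (by omega)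
      rw [← heq] at hw₀
      obtain ⟨k, hk, _, ht, rfl⟩ := mem_sup.1 hw₀
      obtain ⟨r, rfl⟩ := mem_span_singleton.1 ht
      apply hne
      rw [add_lie, smul_lie, lie_self, ← lie_skew, hk.2 _ hw₁]; simp
    have hKu : K ≤ upperCentral g 4 := by
      refine le_upperCentral_of_finrank_le (fun x hx Y => ?_) hK4
      rw [← lie_skew]
      exact neg_mem ⟨hWb _ _, lie_lie_eq_zero_of_commutes hWb hx.2 Y⟩
    exact map_notMem_upperCentral_four hJ hC hX hW hrank
      (hKu ⟨hJXW, fun w hw => by rw [← lie_skew, (hW w).1 hw, neg_zero]⟩)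
  have hu1top : upperCentral g 1 ≠ ⊤ := fun h => hX0 (hs.eq_zero hX (h ▸ mem_top))
  obtain ⟨U, hU, hU1⟩ := exists_mem_two_notMem_one (g := g) hu1top
  have hu2 := fun T (hT : T ∈ upperCentral g 2) =>
    exists_add_smul_of_mem_two (by omega) h2 hU hU1 hT
  have hdec : ∀ Y, Y ∉ W → ∀ x, ∃ w ∈ W, ∃ a b : ℝ, x = w + (a • Y + b • J Y) := fun Y hY x =>
    exists_decomp_of_finrank_le hJ.sq_eq_neg hWJ (S' := ⊤) (by simp) le_top hY mem_top
      (by rw [finrank_top]; omega) x mem_top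
  have hu2W : upperCentral g 2 ≤ W := le_sup_left.trans hSW
  obtain ⟨Y, -, hY⟩ := Set.not_subset.1 (fun h => hWtop (top_le_iff.1 h) : ¬ ⊤ ≤ W)
  obtain ⟨m, hm⟩ := hZ _ (lie_mem_of_mem_succ' hU Y)
  obtain ⟨n, hn⟩ := hZ _ (lie_mem_of_mem_succ' hU (J Y))
  -- replace `Y` by a complex multiple `Y'` such that `ad (J Y')` kills `U`
  have hY' : m • Y + n • J Y ∉ W := by
    intro h
    obtain ⟨rfl, rfl⟩ := smul_add_smul_notMem hJ.sq_eq_neg hWJ hY h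
    refine hU1 (mem_upperCentral_succ_of_decomp (hdec Y hY) (fun w hw => hab w hw _ (hu2W hU)) ?_ ?_)
    · rw [hm, zero_smul]; exact zero_mem _
    · rw [hn, zero_smul]; exact zero_mem _
  have hN : ∀ T ∈ upperCentral g 2, ⁅J (m • Y + n • J Y), T⁆ = 0 := by
    intro T hT
    obtain ⟨z, hz, r, rfl⟩ := hu2 T hT
    have h1 : ⁅J (m • Y + n • J Y), U⁆ = 0 := by
      simp only [map_add, map_smul, hJ.sq_eq_neg, add_lie, smul_lie, neg_lie, hm, hn]
      module
    rw [lie_add, lie_smul, h1, ← lie_skew, mem_upperCentral_one.1 hz]; simp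
  have h5 := le_finrank_inf_upperCentral (I := W) (fun _ _ _ => hWb _ _) 5 (by omega)
  have hne : W ⊓ upperCentral g 5 ⊓ (upperCentral g 2).map J ≠ ⊥ := by
    intro hbot
    have h1 := finrank_sup_add_finrank_inf_eq (W ⊓ upperCentral g 5) ((upperCentral g 2).map J)
    have h2 : W ⊓ upperCentral g 5 ⊔ (upperCentral g 2).map J ≤ W :=
      sup_le inf_le_left (le_sup_right.trans hSW)
    have h3 := finrank_mono h2
    rw [hbot, finrank_bot, finrank_map_complex hJ] at h1
    omega
  obtain ⟨_, ⟨⟨-, hx5⟩, t, ht, rfl⟩, hx0⟩ := exists_mem_ne_zero_of_ne_bot hne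
  refine map_notMem_upperCentral_five hJ hC hWJ hWb hab (hdec _ hY') hN (hu2W ht) ht ?_ hx5
  rintro rfl
  exact hx0 (map_zero J)

end OneDimensionalCenter

/-! ### One-dimensional center: complex rank two -/

section RankTwo

variable {g : Type*} [LieRing g] [LieAlgebra ℝ g] {J : g →ₗ[ℝ] g}
variable [LieRing.IsNilpotent g]

/-- Since `ad S` is nilpotent, iterating it on a vector outside the kernel of `(ad S)²` reaches a
vector where the third iterate vanishes but the second does not. -/
theorem exists_lie_lie_ne_zero (S : g) (h : ∃ T : g, ⁅S, ⁅S, T⁆⁆ ≠ 0) :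
    ∃ T : g, ⁅S, ⁅S, T⁆⁆ ≠ 0 ∧ ⁅S, ⁅S, ⁅S, T⁆⁆⁆ = 0 := by
  have key : ∀ k, ∀ T : g, ⁅S, ⁅S, T⁆⁆ ∈ upperCentral g k → ⁅S, ⁅S, T⁆⁆ ≠ 0 →
      ∃ T : g, ⁅S, ⁅S, T⁆⁆ ≠ 0 ∧ ⁅S, ⁅S, ⁅S, T⁆⁆⁆ = 0 := by
    intro k
    induction k with
    | zero => intro T h0 h1; exact absurd (mem_upperCentral_zero.1 h0) h1
    | succ k ih =>
      intro T hT hne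
      by_cases h3 : ⁅S, ⁅S, ⁅S, T⁆⁆⁆ = 0
      · exact ⟨T, hne, h3⟩
      · exact ih ⁅S, T⁆ (lie_mem_of_mem_succ' hT S) h3
  obtain ⟨n, hn⟩ := exists_upperCentral_eq_top (g := g)
  obtain ⟨T, hT⟩ := h
  exact key n T (hn ▸ mem_top) hT

/-- If `𝔤_2 ⊕ J𝔤_2` is the kernel of `ad (J X)` and has dimension four, then `ad (J X)` has a
Jordan chain of length three ending in `𝔤_2`, up to a multiple of `J X`. -/
theorem exists_jordan_chain [Module.Finite ℝ g] (hJ : IsComplexStructure J)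
    (hdim : finrank ℝ g = 8) {X : g} (hX : X ∈ upperCentral g 1) (hX0 : X ≠ 0)
    (hZ : ∀ T ∈ upperCentral g 1, ∃ c : ℝ, T = c • X)
    (h2 : finrank ℝ (upperCentral g 2) = 2) {U : g} (hU : U ∈ upperCentral g 2)
    (hU1 : U ∉ upperCentral g 1) (h4 : finrank ℝ (kerLieMap J X) = 4)
    (hS : upperCentral g 2 ⊔ (upperCentral g 2).map J = kerLieMap J X) :
    ∃ Y P : g, ∃ s : ℝ, P ∈ upperCentral g 2 ∧ P ∉ upperCentral g 1 ∧
      ⁅J X, ⁅J X, Y⁆⁆ = P + s • J X := by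
  have hDD : ∃ T : g, ⁅J X, ⁅J X, T⁆⁆ ≠ 0 := by
    by_contra! hcon
    have hle : LinearMap.range (LieAlgebra.ad ℝ g (J X)) ≤ kerLieMap J X := by
      rintro _ ⟨T, rfl⟩
      exact mem_kerLieMap.2 (hcon T)
    have h1 := LinearMap.finrank_range_add_finrank_ker (LieAlgebra.ad ℝ g (J X))
    have heq := eq_of_le_of_finrank_le hle (by unfold kerLieMap at *; omega)
    have hXr : X ∈ LinearMap.range (LieAlgebra.ad ℝ g (J X)) := by
      rw [heq, mem_kerLieMap, ← lie_skew, mem_upperCentral_one.1 hX, neg_zero]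
    obtain ⟨T, hT⟩ := hXr
    have hT' : ⁅J X, T⁆ = (1 : ℝ) • X + (0 : ℝ) • J X := by simpa using hT
    have := lie_eq_zero_of_mem_span_self hJ hX hT'
    exact hX0 (by rw [← hT]; exact this)
  obtain ⟨Y, hY, hY3⟩ := exists_lie_lie_ne_zero (J X) hDD
  have hB := mem_kerLieMap.2 hY3
  rw [← hS] at hB
  obtain ⟨p, hp, _, ⟨q, hq, rfl⟩, hpq⟩ := mem_sup.1 hB
  obtain ⟨z₁, hz₁, p₂, rfl⟩ := exists_add_smul_of_mem_two (by omega) h2 hU hU1 hp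
  obtain ⟨z₂, hz₂, q₂, rfl⟩ := exists_add_smul_of_mem_two (by omega) h2 hU hU1 hq
  obtain ⟨c₁, rfl⟩ := hZ _ hz₁
  obtain ⟨c₂, rfl⟩ := hZ _ hz₂
  have hDJ : ⁅J X, ⁅J X, J Y⁆⁆ = J ⁅J X, ⁅J X, Y⁆⁆ := by
    rw [lie_map_of_central hJ hX, lie_map_of_central hJ hX]
  have hB' : ⁅J X, ⁅J X, p₂ • Y + (-q₂) • J Y⁆⁆ =
      p₂ • (c₁ • X + p₂ • U) + q₂ • (c₂ • X + q₂ • U) + (p₂ * c₂ - q₂ * c₁) • J X := by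
    simp only [lie_add, lie_smul]
    rw [hDJ, ← hpq]
    simp only [map_add, map_smul, hJ.sq_eq_neg]
    module
  refine ⟨p₂ • Y + (-q₂) • J Y, _, _, add_mem (smul_mem _ _ hp) (smul_mem _ _ hq), ?_, hB'⟩
  -- otherwise a complex multiple of `X` would be a nonzero element of the image of `ad (J X)`
  intro hP
  obtain ⟨c, hc⟩ := hZ _ hP
  rw [hc] at hB'
  have h0 := lie_eq_zero_of_mem_span_self hJ hX hB'
  simp only [lie_add, lie_smul] at h0
  rw [hDJ] at h0
  obtain ⟨rfl, hq0⟩ := eq_zero_of_smul_add_smul hJ hY h0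
  have hq0' : q₂ = 0 := by simpa using hq0
  subst hq0'
  have h5 : ⁅J X, ⁅J X, Y⁆⁆ = c₁ • X + c₂ • J X := by
    rw [← hpq]; simp
  exact hY (lie_eq_zero_of_mem_span_self hJ hX h5)

/-- With one-dimensional center and `𝔤_2 ∩ J𝔤_2 = 0`, the kernel of `ad (J X)` cannot have
complex codimension two: along a Jordan chain `Y ↦ A ↦ U` of `ad (J X)` with `U ∈ 𝔤_2`, all
brackets of `J U` turn out to be central. -/
theorem finrank_kerLieMap_ne_four [Module.Finite ℝ g] (hJ : IsComplexStructure J)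
    (hs : IsStronglyNonNilpotent J) (hdim : finrank ℝ g = 8)
    (hC : ∀ T : g, T ∈ upperCentral g 2 → J T ∈ upperCentral g 2 → T = 0) {X : g}
    (hX : X ∈ upperCentral g 1) (hX0 : X ≠ 0)
    (hZ : ∀ T ∈ upperCentral g 1, ∃ c : ℝ, T = c • X) :
    finrank ℝ (kerLieMap J X) ≠ 4 := by
  intro h4
  have hSK := sup_map_le_kerLieMap hJ hX hZ
  have hKJ := kerLieMap_stable hJ hX
  have hS := finrank_sup_map_of_inf_eq hJ hC
  have hS4 := finrank_mono hSK
  have h2' := le_finrank_upperCentral (g := g) (k := 2) (by omega)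
  have h2 : finrank ℝ (upperCentral g 2) = 2 := by omega
  have hSeq : upperCentral g 2 ⊔ (upperCentral g 2).map J = kerLieMap J X :=
    eq_of_le_of_finrank_le hSK (by omega)
  have hu1top : upperCentral g 1 ≠ ⊤ := fun h => hX0 (hs.eq_zero hX (h ▸ mem_top))
  have hXl : ∀ T : g, ⁅T, X⁆ = 0 := fun T => by
    rw [← lie_skew, mem_upperCentral_one.1 hX, neg_zero]
  obtain ⟨Y, U, s, hU, hU1, hYU⟩ : ∃ Y P : g, ∃ s : ℝ, P ∈ upperCentral g 2 ∧
      P ∉ upperCentral g 1 ∧ ⁅J X, ⁅J X, Y⁆⁆ = P + s • J X := by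
    obtain ⟨U, hU, hU1⟩ := exists_mem_two_notMem_one (g := g) hu1top
    exact exists_jordan_chain hJ hdim hX hX0 hZ h2 hU hU1 h4 hSeq
  obtain ⟨A, hA⟩ : ∃ A, ⁅J X, Y⁆ = A := ⟨_, rfl⟩
  rw [hA] at hYU
  have hU0 : U ≠ 0 := fun h => hU1 (h ▸ zero_mem _)
  have hDU : ⁅J X, U⁆ = 0 := mem_kerLieMap.1 (upperCentral_two_le_kerLieMap hJ hX hZ hU)
  have hDJU : ⁅J X, J U⁆ = 0 := by rw [lie_map_of_central hJ hX, hDU, map_zero]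
  have hUT : ∀ T : g, ∃ c : ℝ, ⁅U, T⁆ = c • X := fun T => hZ _ (lie_mem_of_mem_succ hU T)
  have hUD : ∀ T : g, ⁅U, ⁅J X, T⁆⁆ = 0 := by
    intro T
    obtain ⟨c, hc⟩ := hUT T
    have h1 := leibniz_lie (J X) U T
    rw [hc, lie_smul, hXl, smul_zero, hDU, zero_lie, zero_add] at h1
    exact h1.symm
  have hUA : ⁅U, A⁆ = 0 := hA ▸ hUD Y
  have hs0 : s = 0 := by
    by_contra hs0
    have h1 : ⁅A, U + s • J X⁆ = (-s) • (U + s • J X) := by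
      rw [← lie_skew, add_lie, smul_lie, hUA, hYU, zero_add, neg_smul]
    have h3 := eq_zero_of_lie_eq_smul h1 (neg_ne_zero.2 hs0)
    refine hX0 (eq_zero_of_map_mem_two hJ hs hX ?_)
    rw [← smul_mem_iff _ hs0, eq_neg_of_add_eq_zero_right h3]
    exact neg_mem hU
  rw [hs0, zero_smul, add_zero] at hYU
  have hDJY : ⁅J X, J Y⁆ = J A := by rw [lie_map_of_central hJ hX, hA]
  have hDJA : ⁅J X, J A⁆ = J U := by rw [lie_map_of_central hJ hX, hYU]
  have hUJA : ⁅U, J A⁆ = 0 := hDJY ▸ hUD (J Y)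
  have hUJU : ⁅U, J U⁆ = 0 := hDJA ▸ hUD (J A)
  have hAK : A ∉ kerLieMap J X := fun h => hU0 (hYU ▸ mem_kerLieMap.1 h)
  have hKA := adjoinComplex_stable hJ.sq_eq_neg hKJ (T := A)
  have hYK : Y ∉ adjoinComplex J (kerLieMap J X) A := by
    intro h
    obtain ⟨k, hk, a, b, hY⟩ := mem_adjoinComplex.1 h
    have h1 : ⁅J X, ⁅J X, Y⁆⁆ = 0 := by
      rw [hY]
      simp only [lie_add, lie_smul, mem_kerLieMap.1 hk, hYU, hDJA, hDU, hDJU, lie_zero, smul_zero,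
        add_zero]
    rw [hA, hYU] at h1
    exact hU0 h1
  have hrank := finrank_adjoinComplex hJ.sq_eq_neg hKJ hAK
  have hdec : ∀ x : g, ∃ k ∈ kerLieMap J X, ∃ a b c d : ℝ,
      x = k + (a • A + b • J A) + (c • Y + d • J Y) := by
    intro x
    obtain ⟨t, ht, c, d, rfl⟩ := exists_decomp_of_finrank_le hJ.sq_eq_neg hKA (S' := ⊤) (by simp)
      le_top hYK mem_top (by rw [finrank_top]; omega) x mem_top
    obtain ⟨k, hk, a, b, rfl⟩ := mem_adjoinComplex.1 ht
    exact ⟨k, hk, a, b, c, d, rfl⟩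
  have hK : ∀ k ∈ kerLieMap J X, ∃ c₁ b₁ c₂ b₂ : ℝ,
      k = c₁ • X + b₁ • U + (c₂ • J X + b₂ • J U) := by
    intro k hk
    rw [← hSeq] at hk
    obtain ⟨p, hp, _, ⟨q, hq, rfl⟩, rfl⟩ := mem_sup.1 hk
    obtain ⟨z₁, hz₁, b₁, rfl⟩ := exists_add_smul_of_mem_two (by omega) h2 hU hU1 hp
    obtain ⟨z₂, hz₂, b₂, rfl⟩ := exists_add_smul_of_mem_two (by omega) h2 hU hU1 hq
    obtain ⟨c₁, rfl⟩ := hZ _ hz₁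
    obtain ⟨c₂, rfl⟩ := hZ _ hz₂
    exact ⟨c₁, b₁, c₂, b₂, by simp only [map_add, map_smul]⟩
  have hEJX : ⁅J U, J X⁆ = 0 := by rw [← lie_skew, hDJU, neg_zero]
  have hEU : ⁅J U, U⁆ = 0 := by rw [← lie_skew, hUJU, neg_zero]
  have hEK : ∀ k ∈ kerLieMap J X, ⁅J U, k⁆ = 0 := by
    intro k hk
    obtain ⟨c₁, b₁, c₂, b₂, rfl⟩ := hK k hk
    simp only [lie_add, lie_smul, hXl, hEU, hEJX, lie_self, smul_zero, add_zero]
  have hED : ∀ T : g, ⁅J U, ⁅J X, T⁆⁆ = ⁅J X, ⁅J U, T⁆⁆ := by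
    intro T
    rw [leibniz_lie, hEJX, zero_lie, zero_add]
  obtain ⟨k, hk, a₁, a₂, y₁, y₂, hEY⟩ := hdec ⁅J U, Y⁆
  have hEA' : ⁅J U, A⁆ = a₁ • U + a₂ • J U + (y₁ • A + y₂ • J A) := by
    rw [← hA, hED, hEY]
    simp only [lie_add, lie_smul, mem_kerLieMap.1 hk, hYU, hDJA, hA, hDJY, zero_add]
  have hy : y₁ • U + y₂ • J U = 0 := by
    have h1 : ⁅J X, ⁅J U, A⁆⁆ = 0 := by rw [← hED, hYU, hEU]
    rw [hEA'] at h1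
    simpa only [lie_add, lie_smul, hDU, hDJU, hYU, hDJA, smul_zero, zero_add] using h1
  obtain ⟨rfl, rfl⟩ := eq_zero_of_smul_add_smul hJ hU0 hy
  simp only [zero_smul, add_zero] at hEA' hEY
  have ha₂ : a₂ = 0 := by
    by_contra ha₂
    have h1 : J U ∈ span ℝ {U} := by
      refine mem_of_lie_sub_smul_mem (S := A) (c := -a₂) ?_ ?_ (neg_ne_zero.2 ha₂)
      · intro q hq
        obtain ⟨r, rfl⟩ := mem_span_singleton.1 hq
        rw [lie_smul, ← lie_skew, hUA]; simp
      · rw [← lie_skew, hEA']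
        exact mem_span_singleton.2 ⟨-a₁, by module⟩
    obtain ⟨r, hr⟩ := mem_span_singleton.1 h1
    exact hU0 (eq_zero_of_map_eq_smul hJ hr.symm)
  subst ha₂
  rw [zero_smul, add_zero] at hEA'
  have hEJA : ⁅J U, J A⁆ = a₁ • J U := by
    rw [hJ.lie_map_map, hUA, hUJA, hEA']; simp
  have ha₁ : a₁ = 0 := by
    by_contra ha₁
    refine map_ne_zero_of_ne_zero hJ hU0 (eq_zero_of_lie_eq_smul (S := J A) (c := -a₁) ?_
      (neg_ne_zero.2 ha₁))
    rw [← lie_skew, hEJA, neg_smul]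
  subst ha₁
  simp only [zero_smul, add_zero] at hEA' hEJA hEY
  obtain ⟨c₁, b₁, c₂, b₂, rfl⟩ := hK k hk
  have hUY : ⁅U, Y⁆ = 0 := by
    obtain ⟨c, hc⟩ := hUT Y
    have h1 : ⁅J X, ⁅A, Y⁆⁆ = c • X + (0 : ℝ) • J X := by
      rw [leibniz_lie, hYU, hA, lie_self, hc]; simp
    have h3 := lie_eq_zero_of_mem_span_self hJ hX h1
    rw [leibniz_lie, hYU, hA, lie_self, add_zero] at h3
    exact h3
  obtain ⟨u, hu⟩ := hUT (J Y)
  have hEJY : ⁅J U, J Y⁆ = b₁ • J U - b₂ • U + (-c₂ • X + (c₁ + u) • J X) := by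
    rw [hJ.lie_map_map, hUY, hEY, hu]
    simp only [map_add, map_smul, hJ.sq_eq_neg]
    module
  -- `[J U, J Y]` lies in the image of `ad (J X)`, so its component along `X` vanishes
  have hcoef : c₂ = 0 ∧ c₁ + u = 0 := by
    have h1 : ⁅J X, ⁅J A, J Y⁆ - (b₁ • J A - b₂ • A)⁆ = (-c₂) • X + (c₁ + u) • J X := by
      rw [lie_sub, leibniz_lie, hDJA, hDJY, lie_self, hEJY]
      simp only [lie_sub, lie_smul, hDJA, hYU]
      module
    have h3 := lie_eq_zero_of_mem_span_self hJ hX h1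
    rw [h1] at h3
    obtain ⟨h5, h6⟩ := eq_zero_of_smul_add_smul hJ hX0 h3
    exact ⟨neg_eq_zero.1 h5, h6⟩
  obtain ⟨rfl, hcu⟩ := hcoef
  have hb₂ : b₂ = 0 := by
    by_contra hb₂
    refine hU0 (hC U hU (mem_of_lie_sub_smul_mem (S := Y) (c := -b₂)
      (fun q hq => lie_mem_upperCentral' hq _) ?_ (neg_ne_zero.2 hb₂)))
    have e : ⁅Y, J U⁆ - (-b₂) • J U = (-c₁) • X + (-b₁) • U := by
      rw [← lie_skew, hEY]; module
    rw [e]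
    exact add_mem (smul_mem _ _ (upperCentral_mono (by norm_num) hX)) (smul_mem _ _ hU)
  subst hb₂
  rw [hcu] at hEJY
  have hb₁ : b₁ = 0 := by
    by_contra hb₁
    refine map_ne_zero_of_ne_zero hJ hU0 (eq_zero_of_lie_eq_smul (S := J Y) (c := -b₁) ?_
      (neg_ne_zero.2 hb₁))
    rw [← lie_skew, hEJY]; module
  subst hb₁
  refine hU0 (hC U hU (mem_upperCentral_succ.2 fun x => ?_))
  obtain ⟨k, hk, a, b, c, d, rfl⟩ := hdec x
  simp only [lie_add, lie_smul, hEK k hk, hEA', hEJA, hEY, hEJY, zero_smul, smul_zero, zero_add,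
    add_zero, neg_zero, sub_zero]
  exact smul_mem _ _ (smul_mem _ _ hX)

end RankTwo

/-! ### Centers of dimension at least two -/

section Center

variable {g : Type*} [LieRing g] [LieAlgebra ℝ g] {J : g →ₗ[ℝ] g}

/-- The `J`-stable subspace `Z + JZ` generated by the center `Z`. -/
def centerComplex (J : g →ₗ[ℝ] g) : Submodule ℝ g := upperCentral g 1 ⊔ (upperCentral g 1).map J

theorem mem_centerComplex {v : g} :
    v ∈ centerComplex J ↔ ∃ P ∈ upperCentral g 1, ∃ Q ∈ upperCentral g 1, v = P + J Q := by
  rw [centerComplex, mem_sup]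
  constructor
  · rintro ⟨P, hP, _, ⟨Q, hQ, rfl⟩, rfl⟩
    exact ⟨P, hP, Q, hQ, rfl⟩
  · rintro ⟨P, hP, Q, hQ, rfl⟩
    exact ⟨P, hP, _, ⟨Q, hQ, rfl⟩, rfl⟩

theorem centerComplex_stable (hJ : IsComplexStructure J) :
    ∀ x ∈ centerComplex J, J x ∈ centerComplex J := sup_map_stable hJ _

theorem finrank_centerComplex [Module.Finite ℝ g] (hJ : IsComplexStructure J)
    (hs : IsStronglyNonNilpotent J) :
    finrank ℝ (centerComplex J) = 2 * finrank ℝ (upperCentral g 1) :=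
  finrank_sup_map_of_inf_eq hJ fun _ h1 h2 => hs.eq_zero h1 h2

theorem lie_centerComplex (hJ : IsComplexStructure J) {X v : g} (hX : X ∈ upperCentral g 1)
    (hv : v ∈ centerComplex J) : ⁅J X, v⁆ = 0 := by
  obtain ⟨P, hP, Q, hQ, rfl⟩ := mem_centerComplex.1 hv
  rw [lie_add, lie_map_of_central hJ hX, ← lie_skew, ← lie_skew (J X) Q,
    mem_upperCentral_one.1 hP, mem_upperCentral_one.1 hQ]
  simp

theorem mem_one_of_mem_centerComplex (hJ : IsComplexStructure J) (hs : IsStronglyNonNilpotent J)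
    {v : g} (hv : v ∈ centerComplex J) (h2 : v ∈ upperCentral g 2) : v ∈ upperCentral g 1 := by
  obtain ⟨P, hP, Q, hQ, rfl⟩ := mem_centerComplex.1 hv
  have h3 : J Q ∈ upperCentral g 2 := by
    rw [← add_sub_cancel_left P (J Q)]
    exact sub_mem h2 (upperCentral_mono (by norm_num) hP)
  rw [eq_zero_of_map_mem_two hJ hs hQ h3, map_zero, add_zero]
  exact hP

/-- A `J`-stable space `W`, of complex codimension one, in the configuration forced by a
two-dimensional center `Z`: the operators `ad (J X)`, `X ∈ Z`, map `𝔤` to `W` and `W` to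
`Z + JZ`. -/
structure IsCenterFlag (J : g →ₗ[ℝ] g) (W : Submodule ℝ g) : Prop where
  finrank_center : finrank ℝ (upperCentral g 1) = 2
  finrank_eq : finrank ℝ W = 6
  stable : ∀ x ∈ W, J x ∈ W
  center_le : centerComplex J ≤ W
  lie_mem : ∀ X ∈ upperCentral g 1, ∀ T, ⁅J X, T⁆ ∈ W
  lie_mem_center : ∀ X ∈ upperCentral g 1, ∀ T ∈ W, ⁅J X, T⁆ ∈ centerComplex J

theorem IsCenterFlag.exists_decomp [Module.Finite ℝ g] (hJ : IsComplexStructure J)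
    (hs : IsStronglyNonNilpotent J) {W : Submodule ℝ g} (hF : IsCenterFlag J W) {A : g}
    (hA : A ∈ W) (hAV : A ∉ centerComplex J) {T : g} (hT : T ∈ W) :
    ∃ v ∈ centerComplex J, ∃ a b : ℝ, T = v + (a • A + b • J A) := by
  have h1 := finrank_centerComplex hJ hs
  rw [hF.finrank_center] at h1
  exact exists_decomp_of_finrank_le hJ.sq_eq_neg (centerComplex_stable hJ) hF.stable hF.center_le
    hAV hA (by rw [hF.finrank_eq, h1]) T hT

variable [LieRing.IsNilpotent g]

/-- The operators `ad (J X)` with `X` central do not all map `𝔤` into `Z + JZ`; otherwise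
`Z + JZ` would be an ideal meeting `𝔤_2` only in `Z`. -/
theorem exists_lie_notMem_centerComplex (hJ : IsComplexStructure J)
    (hs : IsStronglyNonNilpotent J) (h1 : upperCentral g 1 ≠ ⊥) :
    ∃ X ∈ upperCentral g 1, ∃ Y, ⁅J X, Y⁆ ∉ centerComplex J := by
  by_contra! hcon
  obtain ⟨X, hX, hX0⟩ := exists_mem_ne_zero_of_ne_bot h1
  obtain ⟨v, hv, hv2, hv1⟩ := exists_mem_upperCentral_succ (I := centerComplex J) (k := 1) (by
      intro x hx Y
      obtain ⟨P, hP, Q, hQ, rfl⟩ := mem_centerComplex.1 hx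
      rw [add_lie, mem_upperCentral_one.1 hP, zero_add]
      exact hcon Q hQ Y)
    (fun h => hX0 (hs.eq_zero hX (h (mem_centerComplex.2 ⟨0, zero_mem _, X, hX, by simp⟩))))
  exact hv1 (mem_one_of_mem_centerComplex hJ hs hv hv2)

/-- For `dim Z ≥ 2`, the space `W` of all `T` with `[J X, T] ∈ Z + JZ` for central `X` lies strictly
between `Z + JZ` and `𝔤`, which forces `dim Z = 2`. -/
theorem exists_isCenterFlag [Module.Finite ℝ g] (hJ : IsComplexStructure J)
    (hs : IsStronglyNonNilpotent J) (hdim : finrank ℝ g = 8)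
    (hm : 2 ≤ finrank ℝ (upperCentral g 1)) : ∃ W, IsCenterFlag J W := by
  have hne : upperCentral g 1 ≠ ⊥ := by
    intro h
    rw [h, finrank_bot] at hm
    omega
  obtain ⟨X, hX, Y, hXY⟩ := exists_lie_notMem_centerComplex hJ hs hne
  let W : Submodule ℝ g :=
    { carrier := {T | ∀ X ∈ upperCentral g 1, ⁅J X, T⁆ ∈ centerComplex J}
      add_mem' := fun ha hb X hX => by rw [lie_add]; exact add_mem (ha X hX) (hb X hX)
      zero_mem' := fun X _ => by rw [lie_zero]; exact zero_mem _
      smul_mem' := fun c a ha X hX => by rw [lie_smul]; exact smul_mem _ c (ha X hX) }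
  have hWJ : ∀ x ∈ W, J x ∈ W := fun x hx X hX => by
    rw [lie_map_of_central hJ hX]
    exact centerComplex_stable hJ _ (hx X hX)
  have hVW : centerComplex J ≤ W := fun v hv X hX => by
    rw [lie_centerComplex hJ hX hv]; exact zero_mem _
  have hYW : Y ∉ W := fun h => hXY (h X hX)
  have hWtop : W ≠ ⊤ := fun h => hYW (h ▸ mem_top)
  have hVtop : centerComplex J ≠ ⊤ := fun h => hWtop (top_le_iff.1 (h ▸ hVW))
  -- the normalizer of `Z + JZ` is strictly larger than `Z + JZ`
  obtain ⟨k, hk, hk'⟩ := exists_upperCentral_le_not_le hVtop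
  obtain ⟨Y₀, hY₀k, hY₀⟩ := Set.not_subset.1 hk'
  have hY₀W : Y₀ ∈ W := fun X _ => hk (lie_mem_of_mem_succ' hY₀k _)
  have hV := finrank_centerComplex hJ hs
  have h1 := finrank_mono (adjoinComplex_le hWJ hVW hY₀W)
  rw [finrank_adjoinComplex hJ.sq_eq_neg (centerComplex_stable hJ) hY₀] at h1
  have h2 := finrank_add_two_le hJ hWJ hWtop
  have hW6 : finrank ℝ W = 6 := by omega
  have hdec : ∀ x, ∃ w ∈ W, ∃ a b : ℝ, x = w + (a • Y + b • J Y) := fun x =>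
    exists_decomp_of_finrank_le hJ.sq_eq_neg hWJ (S' := ⊤) (by simp) le_top hYW mem_top
      (by rw [finrank_top]; omega) x mem_top
  have hDY : ∀ X ∈ upperCentral g 1, ⁅J X, Y⁆ ∈ W := by
    intro X hX
    obtain ⟨w, hw, a, b, hab⟩ := hdec ⁅J X, Y⁆
    by_cases h0 : a * a - b * (-b) = 0
    · have ha : a = 0 := by nlinarith [mul_self_nonneg a, mul_self_nonneg b]
      have hb : b = 0 := by nlinarith [mul_self_nonneg a, mul_self_nonneg b]
      rw [hab, ha, hb]
      simpa using hw
    · refine absurd (mem_of_lie_pair (S := J X) (T₂ := J Y) (fun q hq => hVW (hq X hX)) ?_ ?_ h0).1 hYW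
      · rw [hab, add_sub_cancel_right]; exact hw
      · rw [lie_map_of_central hJ hX, hab]
        have e : J (w + (a • Y + b • J Y)) - ((-b) • Y + a • J Y) = J w := by
          simp only [map_add, map_smul, hJ.sq_eq_neg]; module
        rw [e]
        exact hWJ w hw
  refine ⟨W, by omega, hW6, hWJ, hVW, fun X hX T => ?_, fun X hX T hT => hT X hX⟩
  obtain ⟨w, hw, a, b, rfl⟩ := hdec T
  rw [lie_add, lie_add, lie_smul, lie_smul, lie_map_of_central hJ hX]
  exact add_mem (hVW (hw X hX)) (add_mem (smul_mem _ _ (hDY X hX))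
    (smul_mem _ _ (hWJ _ (hDY X hX))))

end Center

section CenterFlag

variable {g : Type*} [LieRing g] [LieAlgebra ℝ g] [Module.Finite ℝ g] {J : g →ₗ[ℝ] g}
  {W : Submodule ℝ g}

/-- A basis `X₁, X₂` of the center adapted to `A = [J X₁, Y]`: modulo `Z + JZ`, the bracket
`[J X₂, Y]` is a real multiple of `J A`. -/
theorem IsCenterFlag.exists_basis (hJ : IsComplexStructure J) (hs : IsStronglyNonNilpotent J)
    (hF : IsCenterFlag J W) {X₁ Y : g} (hX₁ : X₁ ∈ upperCentral g 1)
    (hA : ⁅J X₁, Y⁆ ∉ centerComplex J) :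
    ∃ X₂ ∈ upperCentral g 1, X₂ ≠ 0 ∧ (∃ d : ℝ, ∃ v ∈ centerComplex J,
      ⁅J X₂, Y⁆ = d • J ⁅J X₁, Y⁆ + v) ∧
      ∀ T ∈ upperCentral g 1, ∃ x₁ x₂ : ℝ, T = x₁ • X₁ + x₂ • X₂ := by
  have hX₁0 : X₁ ≠ 0 := by
    rintro rfl
    exact hA (by simp)
  have h2 := hF.finrank_center
  have hnle : ¬ upperCentral g 1 ≤ span ℝ {X₁} := by
    intro h
    have h1 := finrank_mono h
    rw [finrank_span_singleton hX₁0] at h1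
    omega
  obtain ⟨X, hX, hXs⟩ := Set.not_subset.1 hnle
  have hlt : span ℝ {X₁} < span ℝ {X₁} ⊔ span ℝ {X} := lt_of_le_of_ne le_sup_left fun e =>
    hXs (by rw [SetLike.mem_coe, e]; exact mem_sup_right (mem_span_singleton_self X))
  have hle : span ℝ {X₁} ⊔ span ℝ {X} ≤ upperCentral g 1 :=
    sup_le ((span_singleton_le_iff_mem _ _).2 hX₁) ((span_singleton_le_iff_mem _ _).2 hX)
  have h3 := finrank_lt_finrank_of_lt hlt
  rw [finrank_span_singleton hX₁0] at h3
  have heq : span ℝ {X₁} ⊔ span ℝ {X} = upperCentral g 1 :=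
    eq_of_le_of_finrank_le hle (by omega)
  obtain ⟨v, hv, c, d, hcd⟩ := hF.exists_decomp hJ hs (hF.lie_mem X₁ hX₁ Y) hA (hF.lie_mem X hX Y)
  refine ⟨X - c • X₁, sub_mem hX (smul_mem _ _ hX₁), ?_, ⟨d, v, hv, ?_⟩, ?_⟩
  · intro h
    rw [sub_eq_zero.1 h] at hXs
    exact hXs (smul_mem _ _ (mem_span_singleton_self X₁))
  · rw [map_sub, map_smul, sub_lie, smul_lie, hcd]
    module
  · intro T hT
    rw [← heq] at hT
    obtain ⟨_, ht, _, ht', rfl⟩ := mem_sup.1 hT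
    obtain ⟨r, rfl⟩ := mem_span_singleton.1 ht
    obtain ⟨r', rfl⟩ := mem_span_singleton.1 ht'
    exact ⟨r + r' * c, r', by module⟩

theorem IsCenterFlag.mem_iff (hJ : IsComplexStructure J) (hs : IsStronglyNonNilpotent J)
    (hdim : finrank ℝ g = 8) (hF : IsCenterFlag J W) {X : g} (hX : X ∈ upperCentral g 1)
    (hX0 : X ≠ 0) (hkill : ∀ T ∈ W, ⁅J X, T⁆ = 0) (T : g) : T ∈ W ↔ ⁅J X, T⁆ = 0 := by
  have hle : W ≤ kerLieMap J X := fun T hT => mem_kerLieMap.2 (hkill T hT)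
  have h1 := finrank_add_two_le hJ (kerLieMap_stable hJ hX) (kerLieMap_ne_top hs hX hX0)
  have h2 := hF.finrank_eq
  have heq := eq_of_le_of_finrank_le hle (by omega)
  rw [heq, mem_kerLieMap]

variable [LieRing.IsNilpotent g]

/-- The operators `ad (J X)`, `X` central, kill `W`. If `R = [J X₁, A] = P + J Q` were nonzero,
nilpotency of `ad A` on `⟨R, J R⟩` would make `P` and `Q` proportional. -/
theorem IsCenterFlag.lie_eq_zero (hJ : IsComplexStructure J) (hs : IsStronglyNonNilpotent J)
    (hdim : finrank ℝ g = 8) (hF : IsCenterFlag J W) :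
    ∀ X ∈ upperCentral g 1, ∀ T ∈ W, ⁅J X, T⁆ = 0 := by
  have hne : upperCentral g 1 ≠ ⊥ := by
    intro h
    have h2 := hF.finrank_center
    rw [h, finrank_bot] at h2
    omega
  obtain ⟨X₁, hX₁, Y, hAV⟩ := exists_lie_notMem_centerComplex hJ hs hne
  obtain ⟨X₂, hX₂, hX₂0, ⟨d, v, hv, hX₂Y⟩, hbasis⟩ := hF.exists_basis hJ hs hX₁ hAV
  have hYW : Y ∉ W := fun h => hAV (hF.lie_mem_center X₁ hX₁ Y h)
  obtain ⟨A, hA⟩ : ∃ A, ⁅J X₁, Y⁆ = A := ⟨_, rfl⟩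
  have hAW : A ∈ W := hA ▸ hF.lie_mem X₁ hX₁ Y
  rw [hA] at hAV hX₂Y
  have hdecW : ∀ T ∈ W, ∃ v ∈ centerComplex J, ∃ a b : ℝ, T = v + (a • A + b • J A) :=
    fun T hT => hF.exists_decomp hJ hs hAW hAV hT
  obtain ⟨R, hR⟩ : ∃ R, ⁅J X₁, A⁆ = R := ⟨_, rfl⟩
  have hX₂A : ⁅J X₂, A⁆ = d • J R := by
    rw [← hA, lie_map_lie_comm hJ hX₂ hX₁, hX₂Y, lie_add, lie_smul, lie_map_of_central hJ hX₁, hR,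
      lie_centerComplex hJ hX₁ hv, add_zero]
  have hXA : ∀ x₁ x₂ : ℝ, ⁅J (x₁ • X₁ + x₂ • X₂), A⁆ = x₁ • R + (x₂ * d) • J R := by
    intro x₁ x₂
    simp only [map_add, map_smul, add_lie, smul_lie, hR, hX₂A, smul_smul]
  have hR0 : R = 0 := by
    by_contra hR0
    obtain ⟨P, hP, Q, hQ, hPQ⟩ := mem_centerComplex.1 (hR ▸ hF.lie_mem_center X₁ hX₁ A hAW)
    obtain ⟨p₁, p₂, hp⟩ := hbasis P hP
    obtain ⟨q₁, q₂, hq⟩ := hbasis Q hQ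
    have hPA := hXA p₁ p₂
    have hQA := hXA q₁ q₂
    rw [← hp] at hPA
    rw [← hq] at hQA
    have hJR : J R = J P - Q := by rw [hPQ, map_add, hJ.sq_eq_neg, sub_eq_add_neg]
    have hAR : ⁅A, R⁆ = (-q₁) • R + (-(q₂ * d)) • J R := by
      rw [← lie_skew, hPQ, add_lie, mem_upperCentral_one.1 hP, ← hPQ, hQA]
      module
    have hAJR : ⁅A, J R⁆ = (-p₁) • R + (-(p₂ * d)) • J R := by
      rw [← lie_skew]
      nth_rw 1 [hJR]
      rw [sub_lie, mem_upperCentral_one.1 hQ, hPA]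
      module
    have hdet : (-q₁) * (-(p₂ * d)) - (-(q₂ * d)) * (-p₁) = 0 := by
      by_contra hdet
      have h := (mem_of_lie_pair (Q := ⊥) (S := A) (T₁ := R) (T₂ := J R) (by simp)
        (by simp [hAR]) (by simp [hAJR]) hdet).1
      exact hR0 (by simpa using h)
    by_cases hd : d = 0
    · -- here `ad (J X₂)` has complex rank one and kernel `W`
      subst hd
      have hW := hF.mem_iff hJ hs hdim hX₂ hX₂0 (fun T hT => by
        obtain ⟨v', hv', a, b, rfl⟩ := hdecW T hT
        simp only [lie_add, lie_smul, lie_centerComplex hJ hX₂ hv', lie_map_of_central hJ hX₂,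
          hX₂A, zero_smul, map_zero, smul_zero, add_zero])
      obtain ⟨hcomm, -⟩ := kernel_commutes_of_rank_one hJ hX₂ hW (by rw [hF.finrank_eq, hdim])
      rw [zero_smul, zero_add] at hX₂Y
      obtain ⟨P', hP', Q', hQ', hv'⟩ := mem_centerComplex.1 hv
      obtain ⟨p₁', p₂', hp'⟩ := hbasis P' hP'
      obtain ⟨q₁', q₂', hq'⟩ := hbasis Q' hQ'
      have h1 : q₁' = 0 := by
        have h := hcomm Y A hAW
        rw [hX₂Y, hv', add_lie, mem_upperCentral_one.1 hP', zero_add, hq', hXA, mul_zero,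
          zero_smul, add_zero] at h
        exact (smul_eq_zero.1 h).resolve_right hR0
      have h2 : p₁' = 0 := by
        have h := hcomm (J Y) A hAW
        rw [lie_map_of_central hJ hX₂, hX₂Y, hv', map_add, hJ.sq_eq_neg, add_lie, neg_lie,
          mem_upperCentral_one.1 hQ', neg_zero, add_zero, hp', hXA, mul_zero,
          zero_smul, add_zero] at h
        exact (smul_eq_zero.1 h).resolve_right hR0
      refine hYW ((hW Y).2 (lie_eq_zero_of_mem_span_self hJ hX₂ (a := p₂') (b := q₂') ?_))
      rw [hX₂Y, hv', hp', hq', h1, h2]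
      simp
    · have hpq : q₁ * p₂ = q₂ * p₁ := by
        have : d * (q₁ * p₂ - q₂ * p₁) = 0 := by linear_combination hdet
        have := (mul_eq_zero.1 this).resolve_left hd
        linarith
      by_cases hP0 : P = 0
      · have h1 : ⁅J Q, A⁆ = (-(q₂ * d)) • Q + q₁ • J Q := by
          rw [hQA, hJR, hPQ, hP0]
          simp only [map_zero]
          module
        have h2 := lie_eq_zero_of_mem_span_self hJ hQ h1
        rw [hQA] at h2
        obtain ⟨h3, h4⟩ := eq_zero_of_smul_add_smul hJ hR0 h2
        have h5 : q₂ = 0 := (mul_eq_zero.1 h4).resolve_right hd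
        apply hR0
        rw [hPQ, hP0, hq, h3, h5]
        simp
      · obtain ⟨r, hr⟩ : ∃ r : ℝ, Q = r • P := by
          by_cases hp₁ : p₁ = 0
          · have hp₂ : p₂ ≠ 0 := by
              rintro rfl
              exact hP0 (by rw [hp, hp₁]; simp)
            have hq₁ : q₁ = 0 := by
              rw [hp₁, mul_zero] at hpq
              exact (mul_eq_zero.1 hpq).resolve_right hp₂
            refine ⟨q₂ / p₂, ?_⟩
            rw [hq, hp, hp₁, hq₁, smul_add, smul_smul, smul_smul, div_mul_cancel₀ _ hp₂, mul_zero]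
          · refine ⟨q₁ / p₁, ?_⟩
            have : q₁ / p₁ * p₂ = q₂ := by
              rw [div_mul_eq_mul_div, hpq, mul_div_assoc, div_self hp₁, mul_one]
            rw [hq, hp, smul_add, smul_smul, smul_smul, div_mul_cancel₀ _ hp₁, this]
        have h1 : ⁅J P, A⁆ = (p₁ - p₂ * d * r) • P + (p₁ * r + p₂ * d) • J P := by
          rw [hPA, hJR, hPQ, hr, map_smul]
          module
        have h2 := lie_eq_zero_of_mem_span_self hJ hP h1
        rw [hPA] at h2
        obtain ⟨h3, h4⟩ := eq_zero_of_smul_add_smul hJ hR0 h2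
        have h5 : p₂ = 0 := (mul_eq_zero.1 h4).resolve_right hd
        apply hP0
        rw [hp, h3, h5]
        simp
  intro X hX T hT
  obtain ⟨v', hv', a, b, rfl⟩ := hdecW T hT
  obtain ⟨x₁, x₂, rfl⟩ := hbasis X hX
  simp only [lie_add, lie_smul, lie_centerComplex hJ hX hv', lie_map_of_central hJ hX, hXA, hR0,
    map_zero, smul_zero, add_zero]

/-- The configuration forced by a two-dimensional center does not exist. Here `W` is an abelian
ideal, and an element of `W ∩ 𝔤_2` outside the center produces a vector `A` such that `A` and
`J A` are both central. -/
theorem not_isCenterFlag (hJ : IsComplexStructure J) (hs : IsStronglyNonNilpotent J)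
    (hdim : finrank ℝ g = 8) : ¬ IsCenterFlag J W := by
  intro hF
  have hkill := hF.lie_eq_zero hJ hs hdim
  have hne : upperCentral g 1 ≠ ⊥ := by
    intro h
    have h2 := hF.finrank_center
    rw [h, finrank_bot] at h2
    omega
  have hrank : finrank ℝ W + 2 = finrank ℝ g := by rw [hF.finrank_eq, hdim]
  have hWker : ∀ X ∈ upperCentral g 1, X ≠ 0 → ∀ T, T ∈ W ↔ ⁅J X, T⁆ = 0 := fun X hX hX0 =>
    hF.mem_iff hJ hs hdim hX hX0 (hkill X hX)
  have hcomm : ∀ X ∈ upperCentral g 1, ∀ Y T : g, T ∈ W → ⁅⁅J X, Y⁆, T⁆ = 0 := by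
    intro X hX
    by_cases hX0 : X = 0
    · intro Y T _
      simp [hX0]
    · exact (kernel_commutes_of_rank_one hJ hX (hWker X hX hX0) hrank).1
  obtain ⟨X₁, hX₁, Y₀, hAV₀⟩ := exists_lie_notMem_centerComplex hJ hs hne
  have hX₁0 : X₁ ≠ 0 := by
    rintro rfl
    exact hAV₀ (by simp)
  have hWb := (kernel_commutes_of_rank_one hJ hX₁ (hWker X₁ hX₁ hX₁0) hrank).2
  have hcW : ∀ X ∈ upperCentral g 1, ∀ w ∈ W, ⁅w, J X⁆ = 0 := fun X hX w hw => by
    rw [← lie_skew, hkill X hX w hw, neg_zero]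
  have hAW₀ : ⁅J X₁, Y₀⁆ ∈ W := hF.lie_mem X₁ hX₁ Y₀
  have hdecW₀ := fun T (hT : T ∈ W) => hF.exists_decomp hJ hs hAW₀ hAV₀ hT
  have hab : ∀ w ∈ W, ∀ w' ∈ W, ⁅w, w'⁆ = 0 := by
    intro w hw w' hw'
    obtain ⟨v, hv, a, b, rfl⟩ := hdecW₀ w hw
    obtain ⟨P, hP, Q, hQ, rfl⟩ := mem_centerComplex.1 hv
    rw [← lie_map_of_central hJ hX₁]
    simp only [add_lie, smul_lie, mem_upperCentral_one.1 hP, hkill Q hQ w' hw',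
      hcomm X₁ hX₁ _ w' hw', smul_zero, add_zero]
  have hJX₁W : J X₁ ∈ W :=
    hF.center_le (mem_centerComplex.2 ⟨0, zero_mem _, X₁, hX₁, by simp⟩)
  have hWu1 : ¬ W ≤ upperCentral g 1 := fun h => hX₁0 (hs.eq_zero hX₁ (h hJX₁W))
  obtain ⟨T, hTW, hT2, hT1⟩ := exists_mem_upperCentral_succ (I := W) (k := 1)
    (fun _ _ _ => hWb _ _) hWu1
  -- choose `Y` so that `A = [J X₁, Y]` agrees with `T` modulo `Z + JZ`
  obtain ⟨Y, A, hA, hAV, Q₀, hQ₀, hAQ₀⟩ : ∃ Y A : g, ⁅J X₁, Y⁆ = A ∧ A ∉ centerComplex J ∧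
      ∃ Q₀ ∈ upperCentral g 1, A + J Q₀ ∈ upperCentral g 2 := by
    obtain ⟨v, hv, a, b, hTv⟩ := hdecW₀ T hTW
    obtain ⟨P₀, hP₀, Q₀, hQ₀, rfl⟩ := mem_centerComplex.1 hv
    refine ⟨a • Y₀ + b • J Y₀, a • ⁅J X₁, Y₀⁆ + b • J ⁅J X₁, Y₀⁆, ?_, ?_, Q₀, hQ₀, ?_⟩
    · rw [lie_add, lie_smul, lie_smul, lie_map_of_central hJ hX₁]
    · intro h
      refine hT1 (mem_one_of_mem_centerComplex hJ hs ?_ hT2)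
      rw [hTv]
      exact add_mem hv h
    · have h := sub_mem hT2 (upperCentral_mono (show 1 ≤ 2 by norm_num) hP₀)
      convert h using 1
      rw [hTv]
      abel
  have hA0 : A ≠ 0 := fun h => hAV (h ▸ zero_mem _)
  obtain ⟨X₂, hX₂, hX₂0, ⟨d, v, hv, hX₂Y⟩, hbasis⟩ := hF.exists_basis hJ hs hX₁ (hA ▸ hAV)
  rw [hA] at hX₂Y
  have hAW : A ∈ W := hA ▸ hF.lie_mem X₁ hX₁ Y
  have hYW : Y ∉ W := fun h => hAV (hA ▸ hF.lie_mem_center X₁ hX₁ Y h)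
  have hdecW := fun T (hT : T ∈ W) => hF.exists_decomp hJ hs hAW hAV hT
  have hdec : ∀ x, ∃ w ∈ W, ∃ a b : ℝ, x = w + (a • Y + b • J Y) := fun x =>
    exists_decomp_of_finrank_le hJ.sq_eq_neg hF.stable (S' := ⊤) (by simp) le_top hYW mem_top
      (by rw [finrank_top]; omega) x mem_top
  have hXY : ∀ x₁ x₂ : ℝ, ⁅J (x₁ • X₁ + x₂ • X₂), Y⁆ = x₁ • A + x₂ • (d • J A + v) := by
    intro x₁ x₂
    simp only [map_add, map_smul, add_lie, smul_lie, hA, hX₂Y]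
  have hN : ∀ X ∈ upperCentral g 1, ⁅J Y, ⁅J X, Y⁆⁆ = ⁅Y, J ⁅J X, Y⁆⁆ := fun X hX =>
    lie_map_lie_eq hJ hX hWb (hcW X hX) Y
  have hNA : ⁅J Y, A⁆ = ⁅Y, J A⁆ := hA ▸ hN X₁ hX₁
  have hNJA := lie_map_map_of_lie_map_eq hJ hNA
  have hMJ : ∀ X, ⁅Y, J X⁆ = -⁅J X, Y⁆ := fun X => (lie_skew _ _).symm
  have hNJ : ∀ X ∈ upperCentral g 1, ⁅J Y, J X⁆ = -J ⁅J X, Y⁆ := fun X hX => by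
    rw [← lie_skew, lie_map_of_central hJ hX]
  have hz : ∀ P ∈ upperCentral g 1, ∀ S : g, ⁅S, P⁆ = 0 := fun P hP S => by
    rw [← lie_skew, mem_upperCentral_one.1 hP, neg_zero]
  obtain ⟨P, hP, Q, hQ, hPQ⟩ := mem_centerComplex.1 hv
  obtain ⟨p₁, p₂, hp⟩ := hbasis P hP
  obtain ⟨q₁, q₂, hq⟩ := hbasis Q hQ
  have hPY := hXY p₁ p₂
  have hQY := hXY q₁ q₂
  rw [← hp] at hPY
  rw [← hq] at hQY
  -- the relation `[J Y, A₂] = [Y, J A₂]` for `A₂ = [J X₂, Y]`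
  have hstar : (2 * d) • (⁅Y, A⁆ + J ⁅J Y, A⁆) = J ⁅J Q, Y⁆ - ⁅J P, Y⁆ := by
    have h := hN X₂ hX₂
    rw [hX₂Y, hPQ] at h
    simp only [map_add, map_smul, hJ.sq_eq_neg, lie_add, lie_smul, lie_neg, hz P hP, hz Q hQ,
      hMJ P, hNJ Q hQ, hNJA] at h
    linear_combination (norm := module) h
  have hJv : J v ∈ centerComplex J := centerComplex_stable hJ v hv
  by_cases hd : d = 0
  · subst hd
    simp only [mul_zero, zero_smul, zero_add] at hstar hPY hQY hX₂Y
    rw [hPY, hQY] at hstar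
    have h1 : p₁ • A + (-q₁) • J A ∈ centerComplex J := by
      have e : p₁ • A + (-q₁) • J A = q₂ • J v - p₂ • v := by
        simp only [map_add, map_smul] at hstar
        linear_combination (norm := module) hstar
      rw [e]
      exact sub_mem (smul_mem _ _ hJv) (smul_mem _ _ hv)
    obtain ⟨h2, h3⟩ := smul_add_smul_notMem hJ.sq_eq_neg (centerComplex_stable hJ) hAV h1
    refine hYW ((hWker X₂ hX₂ hX₂0 Y).2
      (lie_eq_zero_of_mem_span_self hJ hX₂ (a := p₂) (b := q₂) ?_))
    rw [hX₂Y, hPQ, hp, hq, h2, neg_eq_zero.1 h3]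
    simp
  have hζ₁ : ⁅Y, A⁆ - ⁅J Q₀, Y⁆ ∈ upperCentral g 1 := by
    have h := lie_mem_of_mem_succ' hAQ₀ Y
    rwa [lie_add, hMJ, ← sub_eq_add_neg] at h
  have hζ₂ : ⁅J Y, A⁆ - J ⁅J Q₀, Y⁆ ∈ upperCentral g 1 := by
    have h := lie_mem_of_mem_succ' hAQ₀ (J Y)
    rwa [lie_add, hNJ Q₀ hQ₀, ← sub_eq_add_neg] at h
  have hsum : ⁅Y, A⁆ + J ⁅J Y, A⁆ =
      (⁅Y, A⁆ - ⁅J Q₀, Y⁆) + J (⁅J Y, A⁆ - J ⁅J Q₀, Y⁆) := by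
    rw [map_sub, hJ.sq_eq_neg]
    abel
  have hpq : p₁ = -(d * q₂) ∧ q₁ = d * p₂ := by
    have h1 : (-(q₂ * d) - p₁) • A + (q₁ - p₂ * d) • J A ∈ centerComplex J := by
      have e : (-(q₂ * d) - p₁) • A + (q₁ - p₂ * d) • J A =
          (2 * d) • (⁅Y, A⁆ + J ⁅J Y, A⁆) + p₂ • v - q₂ • J v := by
        rw [hstar, hPY, hQY]
        simp only [map_add, map_smul, hJ.sq_eq_neg]
        module
      rw [e]
      refine sub_mem (add_mem (smul_mem _ _ ?_) (smul_mem _ _ hv)) (smul_mem _ _ hJv)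
      rw [hsum]
      exact mem_centerComplex.2 ⟨_, hζ₁, _, hζ₂, rfl⟩
    obtain ⟨h2, h3⟩ := smul_add_smul_notMem hJ.sq_eq_neg (centerComplex_stable hJ) hAV h1
    constructor <;> linarith
  obtain ⟨hp₁, hq₁⟩ := hpq
  -- `P` and `Q` are dependent, since otherwise `W` would be generated by brackets modulo `Z`
  have hpq0 : p₂ * p₂ + q₂ * q₂ = 0 := by
    by_contra hdet
    apply hWu1
    refine le_of_le_sup_span_lie Set.univ (fun s _ q hq => lie_mem_upperCentral' hq s) ?_
    set F := upperCentral g 1 ⊔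
      span ℝ {z | ∃ s ∈ (Set.univ : Set g), ∃ l ∈ W, ⁅s, l⁆ = z}
    have hb : ∀ s, ∀ l ∈ W, ⁅l, s⁆ ∈ F := fun s l hl => by
      rw [← lie_skew]
      exact neg_mem (mem_sup_right (subset_span ⟨s, trivial, l, hl, rfl⟩))
    have hJW : ∀ X ∈ upperCentral g 1, J X ∈ W := fun X hX =>
      hF.center_le (mem_centerComplex.2 ⟨0, zero_mem _, X, hX, by simp⟩)
    have hAF : A ∈ F := hA ▸ hb Y _ (hJW X₁ hX₁)
    have hJAF : J A ∈ F := by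
      rw [← hA, ← lie_map_of_central hJ hX₁]
      exact hb _ _ (hJW X₁ hX₁)
    have hvF : v ∈ F := by
      have h := sub_mem (hb Y _ (hJW X₂ hX₂)) (smul_mem F d hJAF)
      rwa [hX₂Y, add_sub_cancel_left] at h
    have hJvF : J v ∈ F := by
      have h := add_mem (hb (J Y) _ (hJW X₂ hX₂)) (smul_mem F d hAF)
      rw [lie_map_of_central hJ hX₂, hX₂Y] at h
      simp only [map_add, map_smul, hJ.sq_eq_neg] at h
      convert h using 1
      module
    have hJQF : J Q ∈ F := by
      have h := sub_mem hvF (mem_sup_left hP : P ∈ F)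
      rwa [hPQ, add_sub_cancel_left] at h
    have hJPF : J P ∈ F := by
      have h := add_mem hJvF (mem_sup_left hQ : Q ∈ F)
      rw [hPQ, map_add, hJ.sq_eq_neg] at h
      simpa using h
    rw [hq, hq₁, map_add, map_smul, map_smul] at hJQF
    rw [hp, hp₁, map_add, map_smul, map_smul] at hJPF
    have hdd : d * (p₂ * p₂ + q₂ * q₂) ≠ 0 := mul_ne_zero hd hdet
    have hJX₁F : J X₁ ∈ F := by
      rw [← smul_mem_iff _ hdd]
      convert sub_mem (smul_mem F p₂ hJQF) (smul_mem F q₂ hJPF) using 1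
      module
    have hJX₂F : J X₂ ∈ F := by
      rw [← smul_mem_iff _ hdd]
      convert add_mem (smul_mem F (d * q₂) hJQF) (smul_mem F (d * p₂) hJPF) using 1
      module
    intro w hw
    obtain ⟨v', hv', a, b, rfl⟩ := hdecW w hw
    obtain ⟨P', hP', Q', hQ', rfl⟩ := mem_centerComplex.1 hv'
    obtain ⟨x₁, x₂, rfl⟩ := hbasis Q' hQ'
    rw [map_add, map_smul, map_smul]
    exact add_mem (add_mem (mem_sup_left hP') (add_mem (smul_mem _ _ hJX₁F) (smul_mem _ _ hJX₂F)))
      (add_mem (smul_mem _ _ hAF) (smul_mem _ _ hJAF))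
  have hp₂ : p₂ = 0 := by nlinarith [mul_self_nonneg p₂, mul_self_nonneg q₂]
  have hq₂ : q₂ = 0 := by nlinarith [mul_self_nonneg p₂, mul_self_nonneg q₂]
  have hP0 : P = 0 := by rw [hp, hp₁, hp₂, hq₂]; simp
  have hQ0 : Q = 0 := by rw [hq, hq₁, hp₂, hq₂]; simp
  rw [hP0, hQ0, map_zero, zero_lie, map_zero, sub_zero, smul_eq_zero] at hstar
  have hMN := hstar.resolve_left (mul_ne_zero two_ne_zero hd)
  rw [hsum] at hMN
  have hζ₂0 : ⁅J Y, A⁆ - J ⁅J Q₀, Y⁆ = 0 := by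
    refine hs.eq_zero hζ₂ ?_
    rw [eq_neg_of_add_eq_zero_right hMN]
    exact neg_mem hζ₁
  rw [hζ₂0, map_zero, add_zero] at hMN
  obtain ⟨x₁, x₂, hx⟩ := hbasis Q₀ hQ₀
  have hMA : ⁅Y, A⁆ = x₁ • A + (x₂ * d) • J A := by
    rw [sub_eq_zero.1 hMN, hx, hXY, hPQ, hP0, hQ0, map_zero, add_zero, add_zero, smul_smul]
  have hNA' : ⁅J Y, A⁆ = (-(x₂ * d)) • A + x₁ • J A := by
    rw [sub_eq_zero.1 hζ₂0, ← sub_eq_zero.1 hMN, hMA]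
    simp only [map_add, map_smul, hJ.sq_eq_neg]
    module
  have hdet : x₁ * x₁ - (x₂ * d) * (-(x₂ * d)) = 0 := by
    by_contra hdet
    have h := (mem_of_lie_pair (Q := ⊥) (S := Y) (T₁ := A) (T₂ := J A) (by simp)
      (by simp [hMA]) (by simp [← hNA, hNA']) hdet).1
    exact hA0 (by simpa using h)
  have hx₁ : x₁ = 0 := by nlinarith [mul_self_nonneg x₁, mul_self_nonneg (x₂ * d)]
  have hx₂ : x₂ * d = 0 := by nlinarith [mul_self_nonneg x₁, mul_self_nonneg (x₂ * d)]
  rw [hx₁, hx₂] at hMA hNA'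
  simp only [zero_smul, neg_zero, add_zero] at hMA hNA'
  rw [hMA, hNA', map_zero, smul_zero, add_zero] at hNJA
  have hJAW := hF.stable A hAW
  refine hA0 (hs.eq_zero (mem_upperCentral_succ_of_decomp hdec (fun w hw => hab w hw A hAW) ?_ ?_)
    (mem_upperCentral_succ_of_decomp hdec (fun w hw => hab w hw (J A) hJAW) ?_ ?_))
  · exact mem_upperCentral_zero.2 hMA
  · exact mem_upperCentral_zero.2 hNA'
  · exact mem_upperCentral_zero.2 (hNA ▸ hNA')
  · exact mem_upperCentral_zero.2 hNJA

theorem finrank_center_eq_one (hJ : IsComplexStructure J) (hs : IsStronglyNonNilpotent J)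
    (hdim : finrank ℝ g = 8) : finrank ℝ (upperCentral g 1) = 1 := by
  have h1 := le_finrank_upperCentral (g := g) (k := 1) (by omega)
  by_contra hne
  obtain ⟨W, hW⟩ := exists_isCenterFlag hJ hs hdim (by omega)
  exact not_isCenterFlag hJ hs hdim hW

end CenterFlag

/-! ### The bounds on `𝔤_2` -/

theorem proposition4p3 {g : Type*} [LieRing g] [LieAlgebra ℝ g] [LieRing.IsNilpotent g]
    (hdim : Module.finrank ℝ g = 8) (J : g →ₗ[ℝ] g) (hJ : IsComplexStructure J)
    (hSnN : IsStronglyNonNilpotent J) :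
    (ascendingCentralSeries g 2).toSubmodule ⊓
        (ascendingCentralSeries g 2).toSubmodule.map J ≠ ⊥ ∧
      3 ≤ Module.finrank ℝ (ascendingCentralSeries g 2) ∧
      Module.finrank ℝ (ascendingCentralSeries g 2) ≤ 5 := by
  have : Module.Finite ℝ g := Module.finite_of_finrank_pos (by omega)
  change upperCentral g 2 ⊓ (upperCentral g 2).map J ≠ ⊥ ∧ 3 ≤ finrank ℝ (upperCentral g 2) ∧
    finrank ℝ (upperCentral g 2) ≤ 5
  have hc := finrank_center_eq_one hJ hSnN hdim
  obtain ⟨⟨X, hX⟩, hX0', hXs⟩ := finrank_eq_one_iff'.1 hc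
  have hX0 : X ≠ 0 := fun h => hX0' (Subtype.ext h)
  have hZ : ∀ T ∈ upperCentral g 1, ∃ c : ℝ, T = c • X := fun T hT => by
    obtain ⟨c, h⟩ := hXs ⟨T, hT⟩
    exact ⟨c, (congrArg Subtype.val h).symm⟩
  have hSK := sup_map_le_kerLieMap hJ hX hZ
  have hK6 := finrank_add_two_le hJ (kerLieMap_stable hJ hX) (kerLieMap_ne_top hSnN hX hX0)
  obtain ⟨n, hn⟩ := even_finrank_of_sq_eq_neg hJ.sq_eq_neg (kerLieMap_stable hJ hX)
  have h2 := le_finrank_upperCentral (g := g) (k := 2) (by omega)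
  have hmono := finrank_mono hSK
  have hCne : upperCentral g 2 ⊓ (upperCentral g 2).map J ≠ ⊥ := by
    intro hbot
    have hC : ∀ T : g, T ∈ upperCentral g 2 → J T ∈ upperCentral g 2 → T = 0 := by
      intro T hT hJT
      by_contra hT0
      have h : J T ∈ upperCentral g 2 ⊓ (upperCentral g 2).map J := ⟨hJT, T, hT, rfl⟩
      rw [hbot] at h
      exact map_ne_zero_of_ne_zero hJ hT0 (by simpa using h)
    have hS := finrank_sup_map_of_inf_eq hJ hC
    have h4 := finrank_kerLieMap_ne_four hJ hSnN hdim hC hX hX0 hZ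
    have h6 := finrank_kerLieMap_ne_six hJ hSnN hdim hC hX hX0 hZ
    omega
  refine ⟨hCne, ?_, ?_⟩
  · -- `𝔤_2 ∩ J𝔤_2` is `J`-stable, so it does not contain the central element `X`
    obtain ⟨p, hp⟩ := even_finrank_of_sq_eq_neg hJ.sq_eq_neg (inf_map_stable hJ (upperCentral g 2))
    have hpos : finrank ℝ ↥(upperCentral g 2 ⊓ (upperCentral g 2).map J) ≠ 0 := fun h =>
      hCne (finrank_eq_zero.1 h)
    have hlt : upperCentral g 2 ⊓ (upperCentral g 2).map J < upperCentral g 2 := by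
      refine lt_of_le_of_ne inf_le_left fun e => hX0 (eq_zero_of_map_mem_two hJ hSnN hX ?_)
      have hX2 : X ∈ upperCentral g 2 := upperCentral_mono (by norm_num) hX
      rw [← e] at hX2
      exact (inf_map_stable hJ _ X hX2).1
    have := finrank_lt_finrank_of_lt hlt
    omega
  · -- `𝔤_2 + J𝔤_2` lies in a space of dimension six, and `𝔤_2` itself is not `J`-stable
    have hlt : upperCentral g 2 < upperCentral g 2 ⊔ (upperCentral g 2).map J := by
      refine lt_of_le_of_ne le_sup_left fun e => hX0 (eq_zero_of_map_mem_two hJ hSnN hX ?_)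
      rw [e]
      exact mem_sup_right ⟨X, upperCentral_mono (by norm_num) hX, rfl⟩
    have := finrank_lt_finrank_of_lt hlt
    omega
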